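/- Let $(M,\omega)$ be a compact symplectic manifold (without boundary) and let $L\subset (M,\omega)$ be a compact Lagrangian submanifold. Let $\omega_{can}$ be the canonical symplectic form on $T^*L$ (equal to $\sum_i dx_i\wedge dy_i$ in cotangent coordinates) and fix the following data. * A symplectomorphism $\psi:(V,\omega_{can})\to(U,\omega)$ from an open neighborhood $V$ of the zero section $L$ in $T^*L$ onto an open neighborhood $U$ of $L$ in $M$, restricting to the identity on $L$. * A fiberwise convex open neighborhood $V'$ of the zero section with $\overline{V'}\subset V$, such that $U':=\psi(V')$ satisfies $\overline{U'}\subset U$. * A function $f\in C^\infty(M)$ with $f|_{\overline{U'}}\equiv 1$ and $\operatorname{supp}(f)\subset U$. Let $\mathcal U'$ be the set of submanifolds $L'\subset M$ that are images of $\psi\circ\sigma:L\to M$ for some $\sigma\in\Gamma(T^*L)$ with $\sigma(L)\subset V'$. Such a $\sigma$ is uniquely determined by $L'$, and $\mathcal U'$ carries the $\mathcal C^1$-topology of the corresponding sections. Let $X_\sigma$ be the vertical, fiberwise constant vector field on $T^*L$ defined by $\sigma$, whose value at $(x,p)$ is $\left.\frac{d}{dt}\right|_{t=0}(x,p+t\sigma(x))$.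 Put $X_{L'}:=f\,\psi_*(X_\sigma)\in\mathfrak X(M)$, extended by zero outside $U$. Then for every $L'\in\mathcal U'$ the flow of $X_{L'}$ at time $1$ is a well-defined diffeomorphism $\phi_{L'}\in\operatorname{Diff}(M)$, and the following hold. 1. The map $(\mathcal U',\mathcal C^1)\to(\operatorname{Diff}(M),\mathcal C^1)$, $L'\mapsto\phi_{L'}$, is continuous at the point $L$. 2. The map $(\Omega^2(M)\times\mathcal U',\ \mathcal C^0\times\mathcal C^1)\to(\Omega^2(M),\mathcal C^0)$, $(\omega',L')\mapsto\phi_{L'}^*\omega'$, is continuous at the point $(\omega,L)$. Here $\Omega^2(M)$ is the space of smooth $2$-forms on $M$. The $\mathcal C^0$- and $\mathcal C^1$-topologies are those of uniform convergence on compact subsets of charts of the coordinate expressions, respectively of the coordinate expressions and their first derivatives. -/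

import Mathlib

open Set Topology
open scoped Manifold ContDiff

noncomputable section

namespace LagDef

section Forms

variable {E H M : Type*} [NormedAddCommGroup E] [NormedSpace ℝ E] [TopologicalSpace H]
  [TopologicalSpace M] [ChartedSpace H M]
  {E' H' M' : Type*} [NormedAddCommGroup E'] [NormedSpace ℝ E'] [TopologicalSpace H']
  [TopologicalSpace M'] [ChartedSpace H' M']

/-- A (not necessarily smooth) differential `k`-form on the manifold `M`. -/
abbrev Form (I : ModelWithCorners ℝ E H) (M : Type*) [TopologicalSpace M] [ChartedSpace H M]
    (k : ℕ) : Type _ :=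
  (x : M) → TangentSpace I x [⋀^Fin k]→L[ℝ] ℝ

/-- The pullback `(f^* α)_x (v₁, …, v_k) = α_{f x} (df_x v₁, …, df_x v_k)`. -/
def Form.pullback (I : ModelWithCorners ℝ E H) (I' : ModelWithCorners ℝ E' H') {k : ℕ}
    (f : M → M') (α : Form I' M' k) : Form I M k :=
  fun x => (α (f x)).compContinuousLinearMap (mfderiv I I' f x)

/-- The expression of a form in the chart around `x₀`: a form on the model vector space (meaningful
on the target of the chart). -/
def Form.inChart (I : ModelWithCorners ℝ E H) {k : ℕ} (α : Form I M k) (x₀ : M) :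
    E → E [⋀^Fin k]→L[ℝ] ℝ :=
  Form.pullback 𝓘(ℝ, E) I (extChartAt I x₀).symm α

/-- The exterior derivative of a form on a manifold without boundary, computed at `x` in the
chart around `x`. -/
def Form.d (I : ModelWithCorners ℝ E H) {k : ℕ} (α : Form I M k) : Form I M (k + 1) :=
  fun x => (extDeriv (Form.inChart I α x) (extChartAt I x x)).compContinuousLinearMap
    (mfderiv I 𝓘(ℝ, E) (extChartAt I x) x)

/-- A form (on a manifold without boundary) is smooth if all its chart expressions are. -/
def Form.IsSmooth (I : ModelWithCorners ℝ E H) {k : ℕ} (α : Form I M k) : Prop :=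
  ∀ x₀ : M, ContDiffOn ℝ ∞ (Form.inChart I α x₀) (extChartAt I x₀).target

end Forms

section SmoothForms

variable {E M : Type*} [NormedAddCommGroup E] [NormedSpace ℝ E]
  [TopologicalSpace M] [ChartedSpace E M]

variable {G N : Type*} [NormedAddCommGroup G] [NormedSpace ℝ G]
  [TopologicalSpace N] [ChartedSpace G N]

theorem contDiff_compContinuousLinearMap {k : ℕ} :
    ContDiff ℝ ∞ (fun p : (E [⋀^Fin k]→L[ℝ] ℝ) × (G →L[ℝ] E) =>
      p.1.compContinuousLinearMap p.2) := by
  classical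
  let S : ContinuousMultilinearMap ℝ (fun _ : Fin k => G) ℝ →L[ℝ] (G [⋀^Fin k]→L[ℝ] ℝ) :=
    LinearMap.mkContinuous
      { toFun := fun m => ContinuousMultilinearMap.alternatization m
        map_add' := fun a b => by simp
        map_smul' := fun c a => by
          ext v
          simp only [ContinuousMultilinearMap.alternatization_apply_apply,
            _root_.smul_apply, RingHom.id_apply,
            ContinuousAlternatingMap.smul_apply, Finset.smul_sum]
          exact Finset.sum_congr rfl fun σ _ => smul_comm _ _ _ } (Nat.factorial k) (by
        intro m
        refine ContinuousAlternatingMap.opNorm_le_bound _ (by positivity) fun v => ?_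
        simp only [LinearMap.coe_mk, AddHom.coe_mk,
          ContinuousMultilinearMap.alternatization_apply_apply]
        refine (norm_sum_le _ _).trans ?_
        have : ∀ σ ∈ (Finset.univ : Finset (Equiv.Perm (Fin k))),
            ‖Equiv.Perm.sign σ • m (v ∘ σ)‖ ≤ ‖m‖ * ∏ i, ‖v i‖ := by
          intro σ _
          have h1 : ‖Equiv.Perm.sign σ • m (v ∘ σ)‖ = ‖m (v ∘ σ)‖ := by
            rcases Int.units_eq_one_or (Equiv.Perm.sign σ) with h | h <;> simp [h]
          rw [h1]
          refine (m.le_opNorm _).trans_eq ?_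
          congr 1
          exact Equiv.prod_comp σ fun i => ‖v i‖
        refine (Finset.sum_le_card_nsmul _ _ _ this).trans_eq ?_
        simp [Fintype.card_perm, mul_assoc])
  have hS : ∀ q : G [⋀^Fin k]→L[ℝ] ℝ,
      S q.toContinuousMultilinearMap = (Nat.factorial k : ℝ) • q := by
    intro q
    ext v
    have : ∀ σ : Equiv.Perm (Fin k), Equiv.Perm.sign σ • q (v ∘ σ) = q v := by
      intro σ
      have hp : q (v ∘ σ) = Equiv.Perm.sign σ • q v := q.toAlternatingMap.map_perm v σ
      rw [hp, smul_smul]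
      rcases Int.units_eq_one_or (Equiv.Perm.sign σ) with h | h <;> simp [h]
    change ContinuousMultilinearMap.alternatization _ v = _
    rw [ContinuousMultilinearMap.alternatization_apply_apply]
    simp [this, Fintype.card_perm]
  have hfac : (Nat.factorial k : ℝ) ≠ 0 := by positivity
  have hm : ContDiff ℝ ∞ (fun p : (E [⋀^Fin k]→L[ℝ] ℝ) × (G →L[ℝ] E) =>
      (p.1.compContinuousLinearMap p.2).toContinuousMultilinearMap) := by
    have h1 : ContDiff ℝ ∞ (fun p : (E [⋀^Fin k]→L[ℝ] ℝ) × (G →L[ℝ] E) =>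
        ContinuousMultilinearMap.compContinuousLinearMapContinuousMultilinear ℝ
          (fun _ : Fin k => G) (fun _ => E) ℝ (fun _ => p.2)) :=
      (ContinuousMultilinearMap.contDiff _).comp (contDiff_pi.2 fun _ => contDiff_snd)
    have h2 : ContDiff ℝ ∞ (fun p : (E [⋀^Fin k]→L[ℝ] ℝ) × (G →L[ℝ] E) =>
        p.1.toContinuousMultilinearMap) :=
      (ContinuousAlternatingMap.toContinuousMultilinearMapCLM ℝ (𝕜 := ℝ)
        (E := E) (F := ℝ) (ι := Fin k)).contDiff.comp contDiff_fst
    exact h1.clm_apply h2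
  have h2 := (S.contDiff.comp hm).const_smul ((Nat.factorial k : ℝ)⁻¹)
  convert h2 using 2 with p
  simp [hS, smul_smul, hfac]

variable [IsManifold 𝓘(ℝ, E) ∞ M] [IsManifold 𝓘(ℝ, G) ∞ N]

theorem Form.IsSmooth.pullback {k : ℕ} {α : Form 𝓘(ℝ, G) N k} (hα : Form.IsSmooth 𝓘(ℝ, G) α)
    {f : M → N} (hf : ContMDiff 𝓘(ℝ, E) 𝓘(ℝ, G) ∞ f) :
    Form.IsSmooth 𝓘(ℝ, E) (Form.pullback 𝓘(ℝ, E) 𝓘(ℝ, G) f α) := by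
  intro x₀ y₀ hy₀
  set e := extChartAt 𝓘(ℝ, E) x₀ with he
  set x₁ := f (e.symm y₀) with hx₁
  set e₁ := extChartAt 𝓘(ℝ, G) x₁ with he₁
  set g : E → G := fun y => e₁ (f (e.symm y)) with hg
  have hTo : IsOpen e.target := isOpen_extChartAt_target x₀
  have hsymm : ContMDiffOn 𝓘(ℝ, E) 𝓘(ℝ, E) ∞ e.symm e.target := contMDiffOn_extChartAt_symm x₀
  have hfe : ContMDiffOn 𝓘(ℝ, E) 𝓘(ℝ, G) ∞ (fun y => f (e.symm y)) e.target :=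
    hf.comp_contMDiffOn hsymm
  have hS : ∀ᶠ y in 𝓝 y₀, y ∈ e.target ∧ f (e.symm y) ∈ e₁.source := by
    refine Filter.Eventually.and (hTo.mem_nhds hy₀) ?_
    have hc : ContinuousAt (fun y => f (e.symm y)) y₀ :=
      (hfe.continuousOn y₀ hy₀).continuousAt (hTo.mem_nhds hy₀)
    exact hc.eventually ((isOpen_extChartAt_source (I := 𝓘(ℝ, G)) x₁).mem_nhds
      (mem_extChartAt_source x₁))
  have hgat : ∀ y, y ∈ e.target ∧ f (e.symm y) ∈ e₁.source → ContDiffAt ℝ ∞ g y := by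
    intro y hy
    have h1 : ContMDiffAt 𝓘(ℝ, G) 𝓘(ℝ, G) ∞ e₁ (f (e.symm y)) :=
      contMDiffAt_extChartAt' (by simpa [he₁] using hy.2)
    have h2 := h1.comp y ((hfe y hy.1).contMDiffAt (hTo.mem_nhds hy.1))
    exact h2.contDiffAt
  have hg₀ : ContDiffAt ℝ ∞ g y₀ := hgat y₀ hS.self_of_nhds
  have hα₁ : ContDiffAt ℝ ∞ (Form.inChart 𝓘(ℝ, G) α x₁) (g y₀) :=
    (hα x₁ (g y₀) (mem_extChartAt_target x₁)).contDiffAt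
      ((isOpen_extChartAt_target x₁).mem_nhds (mem_extChartAt_target x₁))
  have hmain : ContDiffAt ℝ ∞ (fun y => (Form.inChart 𝓘(ℝ, G) α x₁ (g y)).compContinuousLinearMap
      (fderiv ℝ g y)) y₀ := by
    have h1 : ContDiffAt ℝ ∞ (fderiv ℝ g) y₀ := hg₀.fderiv_right (by simp)
    exact contDiff_compContinuousLinearMap.contDiffAt.comp y₀ ((hα₁.comp y₀ hg₀).prodMk h1)
  refine (hmain.congr_of_eventuallyEq ?_).contDiffWithinAt
  filter_upwards [hS.eventually_nhds] with y hy
  have hy0 := hy.self_of_nhds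
  have key : ∀ (p q : N) (A : E →L[ℝ] G), p = q →
      (α p).compContinuousLinearMap A = (α q).compContinuousLinearMap A := by
    rintro p _ A rfl; rfl
  have hbase : e₁.symm (g y) = f (e.symm y) := e₁.left_inv hy0.2
  have hgm : MDifferentiableAt 𝓘(ℝ, E) 𝓘(ℝ, G) g y :=
    ((hgat y hy0).differentiableAt (by simp)).mdifferentiableAt
  have htgt : g y ∈ e₁.target := e₁.map_source hy0.2
  have hs1 : MDifferentiableAt 𝓘(ℝ, G) 𝓘(ℝ, G) e₁.symm (g y) :=
    (((contMDiffOn_extChartAt_symm (n := ∞) x₁) (g y) htgt).contMDiffAt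
      ((isOpen_extChartAt_target x₁).mem_nhds htgt)).mdifferentiableAt (by simp)
  have hs0 : MDifferentiableAt 𝓘(ℝ, E) 𝓘(ℝ, E) e.symm y :=
    ((hsymm y hy0.1).contMDiffAt (hTo.mem_nhds hy0.1)).mdifferentiableAt (by simp)
  have hff : MDifferentiableAt 𝓘(ℝ, E) 𝓘(ℝ, G) f (e.symm y) :=
    (hf _).mdifferentiableAt (by simp)
  have hev : (fun z => e₁.symm (g z)) =ᶠ[𝓝 y] (fun z => f (e.symm z)) := by
    filter_upwards [hy] with z hz
    exact e₁.left_inv hz.2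
  have hd : (mfderiv 𝓘(ℝ, G) 𝓘(ℝ, G) e₁.symm (g y)).comp (mfderiv 𝓘(ℝ, E) 𝓘(ℝ, G) g y) =
      ((mfderiv 𝓘(ℝ, E) 𝓘(ℝ, G) f (e.symm y)).comp (mfderiv 𝓘(ℝ, E) 𝓘(ℝ, E) e.symm y) :
        E →L[ℝ] G) := by
    have h1 := mfderiv_comp y hs1 hgm
    have h2 := mfderiv_comp y hff hs0
    have h3 := hev.mfderiv_eq (I := 𝓘(ℝ, E)) (I' := 𝓘(ℝ, G))
    exact h1.symm.trans (h3.trans h2)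
  rw [mfderiv_eq_fderiv] at hd
  have := key _ _ ((mfderiv 𝓘(ℝ, E) 𝓘(ℝ, G) f (e.symm y)).comp
    (mfderiv 𝓘(ℝ, E) 𝓘(ℝ, E) e.symm y)) hbase
  refine Eq.trans (b := ((α (f (e.symm y))).compContinuousLinearMap
    ((mfderiv 𝓘(ℝ, E) 𝓘(ℝ, G) f (e.symm y)).comp
    (mfderiv 𝓘(ℝ, E) 𝓘(ℝ, E) e.symm y)) : E [⋀^Fin k]→L[ℝ] ℝ)) rfl ?_
  refine this.symm.trans ?_
  rw [← hd]
  rfl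

/-- The space `Ω^k(M)` of smooth differential `k`-forms on the manifold `M`. -/
structure Omega (E M : Type*) [NormedAddCommGroup E] [NormedSpace ℝ E] [TopologicalSpace M]
    [ChartedSpace E M] (k : ℕ) where
  /-- The underlying form. -/
  form : Form 𝓘(ℝ, E) M k
  smooth : Form.IsSmooth 𝓘(ℝ, E) form

/-- The `C⁰` topology on `Ω^k(M)`: uniform convergence, on every compact subset of every
coordinate patch, of the coordinate expressions. -/
instance {k : ℕ} : TopologicalSpace (Omega E M k) :=
  ⨅ x₀ : M, TopologicalSpace.induced
    (fun α : Omega E M k =>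
      UniformOnFun.ofFun {K : Set E | K ⊆ (extChartAt 𝓘(ℝ, E) x₀).target ∧ IsCompact K}
        (Form.inChart 𝓘(ℝ, E) α.form x₀))
    inferInstance

/-- A symplectic form: a closed and nondegenerate `2`-form. -/
structure IsSymplectic (α : Omega E M 2) : Prop where
  closed : ∀ x : M, Form.d 𝓘(ℝ, E) α.form x = 0
  nondegenerate : ∀ (x : M) (v : TangentSpace 𝓘(ℝ, E) x),
    (∀ w : TangentSpace 𝓘(ℝ, E) x, α.form x ![v, w] = 0) → v = 0

end SmoothForms

section Diffeomorphisms

variable {E M : Type*} [NormedAddCommGroup E] [NormedSpace ℝ E]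
  [TopologicalSpace M] [ChartedSpace E M] [IsManifold 𝓘(ℝ, E) ∞ M]

/-- The group `Diff(M)` of smooth diffeomorphisms of `M`. -/
abbrev Diff (E M : Type*) [NormedAddCommGroup E] [NormedSpace ℝ E] [TopologicalSpace M]
    [ChartedSpace E M] : Type _ :=
  M ≃ₘ^∞⟮𝓘(ℝ, E), 𝓘(ℝ, E)⟯ M

/-- The tangent map `TΦ : TM → TM` of a diffeomorphism, as a continuous map. -/
def Diff.tangent (Φ : Diff E M) : C(TangentBundle 𝓘(ℝ, E) M, TangentBundle 𝓘(ℝ, E) M) where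
  toFun := tangentMap 𝓘(ℝ, E) 𝓘(ℝ, E) Φ
  continuous_toFun := Φ.contMDiff.continuous_tangentMap (by simp)

/-- The `C¹` topology on `Diff(M)`: the topology induced by `Φ ↦ TΦ` from the compact-open topology
on continuous maps `TM → TM`. In charts this is uniform convergence on compact sets of the map and
of its first derivatives. -/
instance : TopologicalSpace (Diff E M) :=
  TopologicalSpace.induced Diff.tangent ContinuousMap.compactOpen

/-- The pullback `Φ^* α` of a smooth form by a diffeomorphism. -/
def Diff.pullback {k : ℕ} (Φ : Diff E M) (α : Omega E M k) : Omega E M k where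
  form := Form.pullback 𝓘(ℝ, E) 𝓘(ℝ, E) Φ α.form
  smooth := α.smooth.pullback Φ.contMDiff

/-- `Φ` is the flow at time one of the (complete) vector field `X`. -/
def IsTimeOneFlow (X : (x : M) → TangentSpace 𝓘(ℝ, E) x) (Φ : Diff E M) : Prop :=
  ∀ m : M, ∃ γ : ℝ → M, γ 0 = m ∧ IsMIntegralCurve γ X ∧ γ 1 = Φ m

end Diffeomorphisms

section Cotangent

variable {F L : Type*} [NormedAddCommGroup F] [NormedSpace ℝ F]
  [TopologicalSpace L] [ChartedSpace F L]

/-- The cotangent space `T_x^* L`. -/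
abbrev CotangentSpace (F : Type*) {L : Type*} [NormedAddCommGroup F] [NormedSpace ℝ F]
    [TopologicalSpace L] [ChartedSpace F L] (x : L) : Type _ :=
  TangentSpace 𝓘(ℝ, F) x →L[ℝ] Bundle.Trivial L ℝ x

/-- The (total space of the) cotangent bundle `T^* L`. -/
abbrev CotangentBundle (F L : Type*) [NormedAddCommGroup F] [NormedSpace ℝ F]
    [TopologicalSpace L] [ChartedSpace F L] : Type _ :=
  Bundle.TotalSpace (F →L[ℝ] ℝ) (fun x : L => CotangentSpace F x)

/-- The model with corners (without boundary) of the manifold `T^* L`. -/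
abbrev cotangentModel (F : Type*) [NormedAddCommGroup F] [NormedSpace ℝ F] :
    ModelWithCorners ℝ (F × (F →L[ℝ] ℝ)) (ModelProd F (F →L[ℝ] ℝ)) :=
  𝓘(ℝ, F).prod 𝓘(ℝ, F →L[ℝ] ℝ)

variable [IsManifold 𝓘(ℝ, F) ∞ L]

/-- The tautological `1`-form on `T^* L`: `λ_{(x, p)} (w) = p (dπ w)`, in cotangent coordinates
`∑ yᵢ dxᵢ`. -/
def tautologicalForm (F L : Type*) [NormedAddCommGroup F] [NormedSpace ℝ F]
    [TopologicalSpace L] [ChartedSpace F L] [IsManifold 𝓘(ℝ, F) ∞ L] :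
    Form (cotangentModel F) (CotangentBundle F L) 1 :=
  fun v => ContinuousAlternatingMap.ofSubsingleton ℝ _ ℝ (0 : Fin 1)
    (v.2.comp (mfderiv (cotangentModel F) 𝓘(ℝ, F)
      (Bundle.TotalSpace.proj : CotangentBundle F L → L) v))

/-- The canonical symplectic form `ω_can = -dλ` on `T^* L`, in cotangent coordinates
`∑ dxᵢ ∧ dyᵢ`. -/
def canonicalForm (F L : Type*) [NormedAddCommGroup F] [NormedSpace ℝ F]
    [TopologicalSpace L] [ChartedSpace F L] [IsManifold 𝓘(ℝ, F) ∞ L] :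
    Form (cotangentModel F) (CotangentBundle F L) 2 :=
  fun v => -Form.d (cotangentModel F) (tautologicalForm F L) v

/-- The space `Γ(T^* L)` of smooth sections of the cotangent bundle. -/
abbrev CotangentSection (F L : Type*) [NormedAddCommGroup F] [NormedSpace ℝ F]
    [TopologicalSpace L] [ChartedSpace F L] [IsManifold 𝓘(ℝ, F) ∞ L] : Type _ :=
  Cₛ^∞⟮𝓘(ℝ, F); F →L[ℝ] ℝ, (CotangentSpace F : L → Type _)⟯

/-- The coordinate expression of a section of `T^* L` in the chart around `x₀`. -/
def CotangentSection.inChart (σ : CotangentSection F L) (x₀ : L) : F → (F →L[ℝ] ℝ) :=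
  fun y => (σ ((extChartAt 𝓘(ℝ, F) x₀).symm y)).comp
    (mfderiv 𝓘(ℝ, F) 𝓘(ℝ, F) (extChartAt 𝓘(ℝ, F) x₀).symm y)

/-- The `C¹` topology on `Γ(T^* L)`: uniform convergence, on every compact subset of every
coordinate patch, of the coordinate expressions and of their first derivatives. -/
instance : TopologicalSpace (CotangentSection F L) :=
  ⨅ x₀ : L, TopologicalSpace.induced
    (fun σ : CotangentSection F L =>
      UniformOnFun.ofFun {K : Set F | K ⊆ (extChartAt 𝓘(ℝ, F) x₀).target ∧ IsCompact K}
        (fun y => (σ.inChart x₀ y, fderiv ℝ (σ.inChart x₀) y)))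
    inferInstance

/-- The vertical, fiberwise constant vector field `X_σ` on `T^* L` defined by a section `σ`:
at `(x, p)` it is the velocity at `t = 0` of the curve `t ↦ (x, p + t σ(x))`. -/
def verticalField (σ : CotangentSection F L) :
    (v : CotangentBundle F L) → TangentSpace (cotangentModel F) v :=
  fun v => mfderiv 𝓘(ℝ, ℝ) (cotangentModel F)
    (fun t : ℝ => (⟨v.1, v.2 + t • σ v.1⟩ : CotangentBundle F L)) 0 (1 : ℝ)

end Cotangent

section Nearby

variable {E M : Type*} [NormedAddCommGroup E] [NormedSpace ℝ E]
  [TopologicalSpace M] [ChartedSpace E M]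
  {F L : Type*} [NormedAddCommGroup F] [NormedSpace ℝ F]
  [TopologicalSpace L] [ChartedSpace F L] [IsManifold 𝓘(ℝ, F) ∞ L]

/-- `ι : L → M` is (the inclusion of) a Lagrangian submanifold of `(M, ω)`: a smooth embedding with
`ι^* ω = 0` and `dim M = 2 dim L`. -/
structure IsLagrangian (F : Type*) {L : Type*} [NormedAddCommGroup F] [NormedSpace ℝ F]
    [TopologicalSpace L] [ChartedSpace F L] (om : Omega E M 2) (ι : L → M) : Prop where
  isSmoothEmbedding : Manifold.IsSmoothEmbedding 𝓘(ℝ, F) 𝓘(ℝ, E) ∞ ι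
  isotropic : ∀ x : L, Form.pullback 𝓘(ℝ, F) 𝓘(ℝ, E) ι om.form x = 0
  finrank_eq : Module.finrank ℝ E = 2 * Module.finrank ℝ F

/-- The auxiliary choices: a Weinstein symplectomorphism `ψ : (V, ω_can) → (U, ω)` from an open
neighborhood `V = ψ.source` of the zero section in `T^* L` onto an open neighborhood `U = ψ.target`
of `L` in `M`, restricting to the inclusion on `L`; a smaller fiberwise convex open neighborhood
`V'`, with `U' = ψ(V')`; and a cut-off function `f`. -/
structure WeinsteinData (F : Type*) {L : Type*} [NormedAddCommGroup F] [NormedSpace ℝ F]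
    [TopologicalSpace L] [ChartedSpace F L] [IsManifold 𝓘(ℝ, F) ∞ L] (om : Omega E M 2) (ι : L → M) where
  ψ : OpenPartialHomeomorph (CotangentBundle F L) M
  smooth_ψ : ContMDiffOn (cotangentModel F) 𝓘(ℝ, E) ∞ ψ ψ.source
  smooth_symm : ContMDiffOn 𝓘(ℝ, E) (cotangentModel F) ∞ ψ.symm ψ.target
  ψ_zero : ∀ x : L, ψ ⟨x, 0⟩ = ι x
  symplectic : ∀ v ∈ ψ.source,
    Form.pullback (cotangentModel F) 𝓘(ℝ, E) ψ om.form v = canonicalForm F L v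
  V' : Set (CotangentBundle F L)
  isOpen_V' : IsOpen V'
  zero_mem_V' : ∀ x : L, (⟨x, 0⟩ : CotangentBundle F L) ∈ V'
  closure_V' : closure V' ⊆ ψ.source
  closure_U' : closure (ψ '' V') ⊆ ψ.target
  convex_V' : ∀ x : L, Convex ℝ {p : CotangentSpace F x | (⟨x, p⟩ : CotangentBundle F L) ∈ V'}
  f : C^∞⟮𝓘(ℝ, E), M; 𝓘(ℝ, ℝ), ℝ⟯
  f_eq_one : ∀ m ∈ closure (ψ '' V'), f m = 1
  tsupport_f : tsupport f ⊆ ψ.target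

namespace WeinsteinData

variable {om : Omega E M 2} {ι : L → M} (W : WeinsteinData F om ι)

/-- The submanifold `L'` of `M` is the image of `ψ ∘ σ` with `σ ∈ Γ_{V'}(T^* L)`. -/
def IsImageOf (L' : Set M) (σ : CotangentSection F L) : Prop :=
  (∀ x : L, (⟨x, σ x⟩ : CotangentBundle F L) ∈ W.V') ∧
    L' = range (fun x : L => W.ψ ⟨x, σ x⟩)

/-- The set `𝒰'` of submanifolds of `M` that are images of `ψ ∘ σ` for some `σ ∈ Γ_{V'}(T^* L)`. -/
def Nearby : Type _ := {L' : Set M // ∃ σ : CotangentSection F L, W.IsImageOf L' σ}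

/-- The section of `T^* L` corresponding to `L' ∈ 𝒰'`. -/
def toSection (L' : W.Nearby) : CotangentSection F L := L'.2.choose

theorem isImageOf_toSection (L' : W.Nearby) : W.IsImageOf L'.1 (W.toSection L') :=
  L'.2.choose_spec

theorem IsImageOf.unique {W : WeinsteinData F om ι} {L' : Set M} {σ τ : CotangentSection F L}
    (hσ : W.IsImageOf L' σ) (hτ : W.IsImageOf L' τ) : σ = τ := by
  ext1 x
  have hx : W.ψ ⟨x, σ x⟩ ∈ range (fun x : L => W.ψ ⟨x, τ x⟩) := by
    rw [← hτ.2, hσ.2]; exact mem_range_self x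
  obtain ⟨y, hy⟩ := hx
  have h := W.ψ.injOn (W.closure_V' (subset_closure (hτ.1 y)))
    (W.closure_V' (subset_closure (hσ.1 x))) hy
  obtain rfl : y = x := congrArg Bundle.TotalSpace.proj h
  exact (Bundle.TotalSpace.mk_injective _ h).symm

/-- The `C¹` topology on `𝒰'`, obtained by identifying `L' ∈ 𝒰'` with its section. -/
instance : TopologicalSpace W.Nearby :=
  TopologicalSpace.induced W.toSection inferInstance

/-- `L` itself, as an element of `𝒰'`; it corresponds to the zero section. -/
def base : W.Nearby :=
  ⟨range ι, 0, W.zero_mem_V', congrArg range (funext fun x => (W.ψ_zero x).symm)⟩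

/-- The vector field `X_{L'} = f ψ_* (X_σ)` on `M`, where `σ` is the section corresponding to `L'`.
The pushforward by `ψ` is the pullback by `ψ⁻¹`; outside of `U` the field vanishes since `f`
does. -/
def field (L' : W.Nearby) : (m : M) → TangentSpace 𝓘(ℝ, E) m :=
  fun m => W.f m • VectorField.mpullback 𝓘(ℝ, E) (cotangentModel F) W.ψ.symm
    (verticalField (W.toSection L')) m

end WeinsteinData

end Nearby

end LagDef

end

/-!
Write `X_σ` for the vertical field of a section `σ` of `T^* L`, and `G` for `f ∘ ψ` extended by
zero. Transported to `T^* L` by `ψ`, the field `f ψ_* X_σ` is `G X_σ`, which is tangent to the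
fibers and, in each fiber, to the lines of direction `σ(x)`. Hence its flow is explicit up to one
scalar equation: it moves `(x, p)` to `(x, p + s(t) σ(x))`, where `s' = G(x, p + s σ(x))` and `s(0)
= 0`. As `G` is bounded the equation has global solutions, and a solution through a zero of `G` is
constant, so the flow preserves `V` and extends by the identity to a diffeomorphism of `M`, whose
inverse is the flow of `-σ` (`WeinsteinData.flowDiff`). It is the only time-one flow, because the
field is `C¹` (`WeinsteinData.eq_flowDiff`).

The time-one flow depends on `σ` through a single map that does not involve `σ`: in cotangent
coordinates it is `(y, p) ↦ (y, R(y, p, σ(y)))`, with `R(y, p, q) = p + s(1) q` (`fiberFlowCoord`).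
The map `R` is smooth (`contDiffAt_fiberFlowCoord`) by smooth dependence of ordinary differential
equations on initial values, obtained here (`exists_contDiffAt_timeOne`) from the inverse function
theorem in the Banach space of continuous curves. By the chain rule, the first jet of the flow is a
continuous function of the first jet of `σ` (`tendsto_jet_comp`). So if `σ` tends to zero in the
`C¹` topology, then in charts the first jet of the flow tends to that of the identity, locally
uniformly (`WeinsteinData.tendsto_flow_jet`).

Both continuity claims follow from this local uniformity and compactness. For the first, the tangent
map of the flow tends to the identity locally uniformly on `TM`
(`WeinsteinData.tendsto_tangentMap_flow`). For the second, the value of `φ^* ω'` at `y` in a chart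
is a continuous function of the first jet of `φ` at `y` and of the value of `ω'` at `φ(y)`, and `ω'`
tends to `ω` uniformly on compact sets (`WeinsteinData.continuousAt_pullback_flowDiff`).
-/

noncomputable section

namespace LagDef

/-! ### Smooth dependence of flows on initial values, and scalar equations -/

section SmoothODE

universe u

open scoped unitInterval BoundedContinuousFunction

/-- Superposition `γ ↦ h ∘ γ` on continuous curves. Here and below, the Banach space of continuous
curves is that of bounded continuous functions on the unit interval. -/
def superpose {E G : Type*} [NormedAddCommGroup E] [NormedAddCommGroup G] (h : C(E, G))
    (γ : I →ᵇ E) : I →ᵇ G :=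
  BoundedContinuousFunction.mkOfCompact (h.comp γ.toContinuousMap)

/-- Pointwise application of a curve of operators to a curve of vectors, as a bounded operator. -/
def pointwiseApply (E G : Type*) [NormedAddCommGroup E] [NormedSpace ℝ E] [NormedAddCommGroup G]
    [NormedSpace ℝ G] : (I →ᵇ (E →L[ℝ] G)) →L[ℝ] (I →ᵇ E) →L[ℝ] (I →ᵇ G) :=
  LinearMap.mkContinuous₂
    (LinearMap.mk₂ ℝ (fun (A : (I →ᵇ (E →L[ℝ] G))) (δ : (I →ᵇ E)) =>
        BoundedContinuousFunction.mkOfCompact ⟨fun t => A t (δ t), by fun_prop⟩)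
      (fun _ _ _ => by ext; simp) (fun _ _ _ => by ext; simp)
      (fun _ _ _ => by ext; simp) (fun _ _ _ => by ext; simp)) 1 (fun A δ => by
        rw [BoundedContinuousFunction.norm_le (by positivity)]
        intro t
        simp only [LinearMap.mk₂_apply, one_mul]
        exact (ContinuousLinearMap.le_opNorm _ _).trans
          (mul_le_mul (A.norm_coe_le_norm t) (δ.norm_coe_le_norm t) (by positivity)
            (by positivity)))

@[simp]
theorem pointwiseApply_apply {E G : Type*} [NormedAddCommGroup E] [NormedSpace ℝ E]
    [NormedAddCommGroup G] [NormedSpace ℝ G] (A : (I →ᵇ (E →L[ℝ] G))) (δ : (I →ᵇ E)) (t : I) :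
    pointwiseApply E G A δ t = A t (δ t) := rfl

theorem continuous_superpose {E G : Type*} [NormedAddCommGroup E] [NormedAddCommGroup G]
    (h : C(E, G)) : Continuous (superpose h) := by
  have h1 : Continuous fun γ : I →ᵇ E => γ.toContinuousMap :=
    (ContinuousMap.isometryEquivBoundedOfCompact I E).symm.continuous
  have h2 : Continuous fun γ : C(I, G) => BoundedContinuousFunction.mkOfCompact γ :=
    (ContinuousMap.isometryEquivBoundedOfCompact I G).continuous
  exact h2.comp ((ContinuousMap.continuous_postcomp h).comp h1)

theorem hasFDerivAt_superpose {E G : Type*} [NormedAddCommGroup E] [NormedSpace ℝ E]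
    [NormedAddCommGroup G] [NormedSpace ℝ G] {h : C(E, G)} {h' : C(E, E →L[ℝ] G)}
    (hd : ∀ x, HasFDerivAt h (h' x) x) (γ : (I →ᵇ E)) :
    HasFDerivAt (superpose h) (pointwiseApply E G (superpose h' γ)) γ := by
  rw [hasFDerivAt_iff_isLittleO_nhds_zero, Asymptotics.isLittleO_iff]
  intro ε hε
  have hc : ContinuousAt (superpose h') γ := (continuous_superpose h').continuousAt
  obtain ⟨r, hr, hball⟩ := Metric.continuousAt_iff.1 hc ε hε
  filter_upwards [Metric.ball_mem_nhds (0 : (I →ᵇ E)) hr] with δ hδ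
  rw [mem_ball_zero_iff] at hδ
  rw [BoundedContinuousFunction.norm_le (by positivity)]
  intro t
  have hseg : ∀ z ∈ segment ℝ (γ t) (γ t + δ t), ‖h' z - h' (γ t)‖ ≤ ε := by
    intro z hz
    rw [segment_eq_image'] at hz
    obtain ⟨θ, hθ, rfl⟩ := hz
    have h1 : dist (γ + θ • δ) γ < r := by
      rw [dist_eq_norm, add_sub_cancel_left, norm_smul, Real.norm_of_nonneg hθ.1]
      exact (mul_le_of_le_one_left (norm_nonneg _) hθ.2).trans_lt hδ
    have h2 := (BoundedContinuousFunction.dist_coe_le_dist t).trans (hball h1).le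
    rw [dist_eq_norm] at h2
    simpa [superpose] using h2
  have := (convex_segment (γ t) (γ t + δ t)).norm_image_sub_le_of_norm_hasFDerivWithin_le'
    (f := h) (fun z _ => (hd z).hasFDerivWithinAt) hseg (left_mem_segment ℝ _ _)
    (right_mem_segment ℝ _ _)
  rw [add_sub_cancel_left] at this
  exact this.trans (mul_le_mul_of_nonneg_left (δ.norm_coe_le_norm t) hε.le)

/-- Superposition with a smooth map is smooth, as its derivative is superposition with the
derivative. The universe of the target is that of the source since the induction passes from `G` to
`E →L[ℝ] G`. -/
theorem contDiff_superpose {E : Type u} [NormedAddCommGroup E] [NormedSpace ℝ E] (n : ℕ) :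
    ∀ {G : Type u} [NormedAddCommGroup G] [NormedSpace ℝ G] (h : C(E, G)), ContDiff ℝ n h →
      ContDiff ℝ n (superpose h) := by
  induction n with
  | zero =>
    intro G _ _ h _
    exact contDiff_zero.2 (continuous_superpose h)
  | succ n ih =>
    intro G _ _ h hh
    have hh' := hh
    push_cast at hh ⊢
    rw [contDiff_succ_iff_hasFDerivAt] at hh
    obtain ⟨h', hh'c, hd⟩ := hh
    rw [contDiff_succ_iff_hasFDerivAt]
    refine ⟨_, ?_, fun γ => hasFDerivAt_superpose (h' := ⟨h', hh'c.continuous⟩) hd γ⟩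
    exact (pointwiseApply E G).contDiff.comp (ih ⟨h', hh'c.continuous⟩ hh'c)

/-- The primitive `t ↦ ∫₀ᵗ γ` of a continuous curve, as a bounded operator. -/
def primitive (E : Type*) [NormedAddCommGroup E] [NormedSpace ℝ E] : (I →ᵇ E) →L[ℝ] (I →ᵇ E) :=
  LinearMap.mkContinuous
    { toFun := fun γ => BoundedContinuousFunction.mkOfCompact
        ⟨fun t => ∫ s in (0 : ℝ)..t, IccExtend zero_le_one γ s, by
        have : Continuous fun t : ℝ => ∫ s in (0 : ℝ)..t, IccExtend zero_le_one γ s :=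
          intervalIntegral.continuous_primitive
            (fun a b => (γ.continuous.Icc_extend').intervalIntegrable a b) 0
        exact this.comp continuous_subtype_val⟩
      map_add' := fun γ δ => by
        ext t
        simp only [BoundedContinuousFunction.mkOfCompact_apply, ContinuousMap.coe_mk,
          BoundedContinuousFunction.add_apply]
        rw [← intervalIntegral.integral_add]
        · rfl
        · exact (γ.continuous.Icc_extend').intervalIntegrable _ _
        · exact (δ.continuous.Icc_extend').intervalIntegrable _ _
      map_smul' := fun c γ => by
        ext t
        simp only [BoundedContinuousFunction.mkOfCompact_apply, ContinuousMap.coe_mk,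
          RingHom.id_apply, BoundedContinuousFunction.smul_apply]
        rw [← intervalIntegral.integral_smul]
        rfl } 1 (fun γ => by
      rw [BoundedContinuousFunction.norm_le (by positivity)]
      intro t
      have := intervalIntegral.norm_integral_le_of_norm_le_const (a := (0 : ℝ)) (b := t) (C := ‖γ‖)
        (f := IccExtend zero_le_one γ) (fun x _ => γ.norm_coe_le_norm _)
      refine this.trans ?_
      rw [sub_zero, abs_of_nonneg t.2.1, one_mul]
      exact mul_le_of_le_one_right (norm_nonneg _) t.2.2)

theorem primitive_apply {E : Type*} [NormedAddCommGroup E] [NormedSpace ℝ E] (γ : I →ᵇ E)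
    (t : I) :
    primitive E γ t = ∫ s in (0 : ℝ)..t, IccExtend zero_le_one γ s := rfl

/-- The Volterra operator `δ ↦ (t ↦ ∫₀ᵗ A δ)`. -/
def volterra {E : Type*} [NormedAddCommGroup E] [NormedSpace ℝ E] (A : (I →ᵇ (E →L[ℝ] E))) :
    (I →ᵇ E) →L[ℝ] (I →ᵇ E) :=
  (primitive E).comp (pointwiseApply E E A)

/-- The iterated integrals behind this bound give the factorial. -/
theorem norm_volterra_pow_apply_le {E : Type*} [NormedAddCommGroup E] [NormedSpace ℝ E]
    (A : (I →ᵇ (E →L[ℝ] E))) (δ : (I →ᵇ E)) (n : ℕ) (t : I) :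
    ‖(volterra A ^ n) δ t‖ ≤ (‖A‖ * t) ^ n / n.factorial * ‖δ‖ := by
  induction n generalizing t with
  | zero => simpa using δ.norm_coe_le_norm t
  | succ n ih =>
    rw [pow_succ']
    change ‖primitive E (pointwiseApply E E A ((volterra A ^ n) δ)) t‖ ≤ _
    rw [primitive_apply]
    have hb : ∀ s ∈ Ioc (0 : ℝ) t, ‖IccExtend zero_le_one
        (pointwiseApply E E A ((volterra A ^ n) δ)) s‖ ≤
        ‖A‖ * ((‖A‖ * s) ^ n / n.factorial * ‖δ‖) := by
      intro s hs
      have hs' : s ∈ Icc (0 : ℝ) 1 := ⟨hs.1.le, hs.2.trans t.2.2⟩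
      rw [IccExtend_of_mem _ _ hs', pointwiseApply_apply]
      exact (ContinuousLinearMap.le_opNorm _ _).trans
        (mul_le_mul (A.norm_coe_le_norm _) (ih ⟨s, hs'⟩) (norm_nonneg _)
          (norm_nonneg A))
    refine (intervalIntegral.norm_integral_le_of_norm_le (μ := MeasureTheory.volume) t.2.1
      (Filter.Eventually.of_forall hb)
      (Continuous.intervalIntegrable (by fun_prop) _ _)).trans_eq ?_
    have : ∀ s : ℝ, ‖A‖ * ((‖A‖ * s) ^ n / n.factorial * ‖δ‖) =
        (‖A‖ ^ (n + 1) / n.factorial * ‖δ‖) * s ^ n := by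
      intro s; rw [mul_pow]; ring
    simp_rw [this]
    rw [intervalIntegral.integral_const_mul, integral_pow, Nat.factorial_succ]
    push_cast
    field_simp
    simp only [zero_pow (Nat.succ_ne_zero n), sub_zero, mul_pow]
    ring

/-- Since the Volterra operator is quasi-nilpotent, some power of it has norm less than one. -/
theorem isUnit_one_sub_volterra {E : Type*} [NormedAddCommGroup E] [NormedSpace ℝ E]
    [CompleteSpace E] (A : (I →ᵇ (E →L[ℝ] E))) : IsUnit (1 - volterra A) := by
  obtain ⟨n, hn⟩ : ∃ n : ℕ, ‖A‖ ^ n / n.factorial < 1 :=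
    ((FloorSemiring.tendsto_pow_div_factorial_atTop ‖A‖).eventually_lt_const one_pos).exists
  have hpow : ‖volterra A ^ n‖ < 1 := by
    refine lt_of_le_of_lt (ContinuousLinearMap.opNorm_le_bound _ (by positivity) fun δ => ?_) hn
    rw [BoundedContinuousFunction.norm_le (by positivity)]
    intro t
    refine (norm_volterra_pow_apply_le A δ n t).trans ?_
    gcongr
    · exact mul_nonneg (norm_nonneg A) t.2.1
    · exact mul_le_of_le_one_right (norm_nonneg A) t.2.2
  have h1 : IsUnit (1 - volterra A ^ n) := isUnit_one_sub_of_norm_lt_one hpow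
  rw [← mul_neg_geom_sum] at h1
  refine ((Commute.isUnit_mul_iff ?_).1 h1).1
  exact Commute.sum_right _ _ _ fun i _ =>
    ((Commute.one_left _).sub_left (Commute.refl _)).pow_right i

/-- The Picard defect `γ ↦ γ - ∫₀ᵗ X(γ)`: a curve solves `γ' = X(γ)`, `γ 0 = x` exactly when its
defect is the constant curve `x`. -/
def picardDefect {E : Type*} [NormedAddCommGroup E] [NormedSpace ℝ E] (X : C(E, E)) (γ : I →ᵇ E) :
    I →ᵇ E :=
  γ - primitive E (superpose X γ)

theorem eqOn_of_hasDerivAt {E : Type*} [NormedAddCommGroup E] [NormedSpace ℝ E]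
    [FiniteDimensional ℝ E] {X : E → E} (hX : ContDiff ℝ 1 X) {γ δ : ℝ → E}
    (hγ : ∀ t ∈ Icc (0 : ℝ) 1, HasDerivAt γ (X (γ t)) t)
    (hδ : ∀ t ∈ Icc (0 : ℝ) 1, HasDerivAt δ (X (δ t)) t) (h0 : γ 0 = δ 0) :
    EqOn γ δ (Icc 0 1) := by
  have hγc : ContinuousOn γ (Icc 0 1) := fun t ht => (hγ t ht).continuousAt.continuousWithinAt
  have hδc : ContinuousOn δ (Icc 0 1) := fun t ht => (hδ t ht).continuousAt.continuousWithinAt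
  obtain ⟨R, hR⟩ := ((isCompact_Icc.image_of_continuousOn hγc).union
    (isCompact_Icc.image_of_continuousOn hδc)).isBounded.subset_closedBall (0 : E)
  have : ProperSpace E := FiniteDimensional.proper ℝ E
  obtain ⟨K, hK⟩ := hX.locallyLipschitz.locallyLipschitzOn.exists_lipschitzOnWith_of_compact
    (isCompact_closedBall (0 : E) R)
  have hsub : Ico (0 : ℝ) 1 ⊆ Icc 0 1 := Ico_subset_Icc_self
  exact ODE_solution_unique_of_mem_Icc_right (v := fun _ => X) (s := fun _ => Metric.closedBall 0 R)
    (fun _ _ => hK) hγc (fun t ht => (hγ t (hsub ht)).hasDerivWithinAt)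
    (fun t ht => hR (Or.inl (mem_image_of_mem _ (hsub ht)))) hδc
    (fun t ht => (hδ t (hsub ht)).hasDerivWithinAt)
    (fun t ht => hR (Or.inr (mem_image_of_mem _ (hsub ht)))) h0

theorem exists_hasDerivAt_of_picardDefect_eq {E : Type*} [NormedAddCommGroup E] [NormedSpace ℝ E]
    [CompleteSpace E] {X : C(E, E)} {γ : I →ᵇ E} {x : E}
    (h : picardDefect X γ = BoundedContinuousFunction.const I x) :
    ∃ δ : ℝ → E, (∀ t : I, δ t = γ t) ∧ δ 0 = x ∧
      ∀ t ∈ Icc (0 : ℝ) 1, HasDerivAt δ (X (δ t)) t := by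
  set w : ℝ → E := IccExtend zero_le_one (superpose X γ) with hw
  have hwc : Continuous w := (superpose X γ).continuous.Icc_extend'
  set δ : ℝ → E := fun t => x + ∫ s in (0 : ℝ)..t, w s with hδ
  have hδγ : ∀ t : I, δ t = γ t := by
    intro t
    have := DFunLike.congr_fun h t
    have h2 : γ t - ∫ s in (0 : ℝ)..t, w s = x := this
    simp only [hδ]
    rw [← h2]
    abel
  refine ⟨δ, hδγ, by simp [hδ], fun t ht => ?_⟩
  have h1 : HasDerivAt δ (w t) t :=
    (intervalIntegral.integral_hasDerivAt_right (hwc.intervalIntegrable _ _)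
      (hwc.stronglyMeasurableAtFilter _ _) hwc.continuousAt).const_add x
  have h2 : w t = X (δ t) := by
    rw [hw, IccExtend_of_mem _ _ ht, show δ t = γ ⟨t, ht⟩ from hδγ ⟨t, ht⟩]
    rfl
  rwa [h2] at h1

theorem picardDefect_eq_of_hasDerivAt {E : Type*} [NormedAddCommGroup E] [NormedSpace ℝ E]
    [CompleteSpace E] {X : C(E, E)} {δ : ℝ → E}
    (h : ∀ t ∈ Icc (0 : ℝ) 1, HasDerivAt δ (X (δ t)) t) {γ : I →ᵇ E} (hγ : ∀ t : I, γ t = δ t) :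
    picardDefect X γ = BoundedContinuousFunction.const I (δ 0) := by
  ext t
  change γ t - ∫ s in (0 : ℝ)..t, IccExtend zero_le_one (superpose X γ) s = δ 0
  have hsub : uIcc (0 : ℝ) t ⊆ Icc 0 1 := by
    rw [uIcc_of_le t.2.1]; exact Icc_subset_Icc_right t.2.2
  have h1 : ∀ s ∈ uIcc (0 : ℝ) t,
      HasDerivAt δ (IccExtend zero_le_one (superpose X γ) s) s := by
    intro s hs
    rw [IccExtend_of_mem _ _ (hsub hs)]
    change HasDerivAt δ (X (γ ⟨s, hsub hs⟩)) s
    rw [hγ]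
    exact h s (hsub hs)
  rw [intervalIntegral.integral_eq_sub_of_hasDerivAt h1
    (((superpose X γ).continuous.Icc_extend').intervalIntegrable _ _), hγ]
  abel

/-- Smooth dependence of the time-one flow on the initial value, near an initial value whose
solution exists up to time one. The Picard defect is a smooth map of the space of curves, and by
quasi-nilpotency of Volterra operators its derivative is invertible; so solutions are obtained from
their initial values by applying its smooth local inverse to constant curves. -/
theorem exists_contDiffAt_timeOne {E : Type u} [NormedAddCommGroup E] [NormedSpace ℝ E]
    [FiniteDimensional ℝ E] {X : E → E} (hX : ContDiff ℝ ∞ X) {γ₀ : ℝ → E}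
    (hγ₀ : ∀ t ∈ Icc (0 : ℝ) 1, HasDerivAt γ₀ (X (γ₀ t)) t) :
    ∃ Θ : E → E, ContDiffAt ℝ ∞ Θ (γ₀ 0) ∧ ∀ᶠ x in 𝓝 (γ₀ 0), ∀ γ : ℝ → E, γ 0 = x →
      (∀ t ∈ Icc (0 : ℝ) 1, HasDerivAt γ (X (γ t)) t) → Θ x = γ 1 := by
  have : CompleteSpace E := FiniteDimensional.complete ℝ E
  set Xc : C(E, E) := ⟨X, hX.continuous⟩ with hXc
  set X' : C(E, E →L[ℝ] E) := ⟨fderiv ℝ X, hX.continuous_fderiv (by simp)⟩ with hX'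
  have hd : ∀ x, HasFDerivAt Xc (X' x) x := fun x =>
    (hX.differentiable (by simp) x).hasFDerivAt
  have hcurve : ∀ γ : ℝ → E, (∀ t ∈ Icc (0 : ℝ) 1, HasDerivAt γ (X (γ t)) t) →
      ∃ c : I →ᵇ E, ∀ t : I, c t = γ t := fun γ hγ =>
    ⟨BoundedContinuousFunction.mkOfCompact ⟨fun t : I => γ t,
      continuous_iff_continuousAt.2 fun t =>
        (hγ t t.2).continuousAt.comp continuous_subtype_val.continuousAt⟩, fun _ => rfl⟩
  obtain ⟨c₀, hc₀⟩ := hcurve γ₀ hγ₀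
  have hsm : ContDiff ℝ ∞ (picardDefect Xc) := by
    rw [contDiff_infty]
    intro n
    exact contDiff_id.sub ((primitive E).contDiff.comp
      (contDiff_superpose n Xc (hX.of_le (by exact_mod_cast le_top))))
  have hder : HasFDerivAt (picardDefect Xc) (1 - volterra (superpose X' c₀)) c₀ :=
    (hasFDerivAt_id c₀).sub ((primitive E).hasFDerivAt.comp c₀ (hasFDerivAt_superpose hd c₀))
  obtain ⟨u, hu⟩ := isUnit_one_sub_volterra (superpose X' c₀)
  have hder' : HasFDerivAt (picardDefect Xc)
      ((ContinuousLinearEquiv.unitsEquiv ℝ (I →ᵇ E) u : (I →ᵇ E) ≃L[ℝ] (I →ᵇ E)) :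
        (I →ᵇ E) →L[ℝ] (I →ᵇ E)) c₀ := by
    convert hder using 1
    exact hu
  set Φ := hsm.contDiffAt.toOpenPartialHomeomorph (picardDefect Xc) hder' (by simp) with hΦ
  have hΦc : ∀ c, Φ c = picardDefect Xc c := fun _ => rfl
  have hmem : c₀ ∈ Φ.source := ContDiffAt.mem_toOpenPartialHomeomorph_source _ _ _
  have himg : Φ c₀ = BoundedContinuousFunction.const I (γ₀ 0) :=
    picardDefect_eq_of_hasDerivAt (X := Xc) hγ₀ hc₀
  have htgt : BoundedContinuousFunction.const I (γ₀ 0) ∈ Φ.target :=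
    himg ▸ Φ.map_source hmem
  have hinv : ContDiffAt ℝ ∞ Φ.symm (BoundedContinuousFunction.const I (γ₀ 0)) := by
    have hs : Φ.symm (BoundedContinuousFunction.const I (γ₀ 0)) = c₀ := by
      rw [← himg, Φ.left_inv hmem]
    refine Φ.contDiffAt_symm htgt (f₀' := ContinuousLinearEquiv.unitsEquiv ℝ (I →ᵇ E) u) ?_ ?_
    · rw [hs]; exact hder'
    · exact hsm.contDiffAt
  have hconst : ContDiff ℝ ∞ (fun x : E => BoundedContinuousFunction.const I x) :=
    (LinearMap.mkContinuous
      { toFun := fun x : E => BoundedContinuousFunction.const I x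
        map_add' := fun _ _ => rfl
        map_smul' := fun _ _ => rfl } 1 fun x => by
          rw [one_mul]
          exact BoundedContinuousFunction.norm_const_le x).contDiff
  refine ⟨fun x => Φ.symm (BoundedContinuousFunction.const I x) 1, ?_, ?_⟩
  · exact (BoundedContinuousFunction.evalCLM ℝ (1 : I)).contDiff.contDiffAt.comp _
      (hinv.comp (γ₀ 0) hconst.contDiffAt)
  · filter_upwards [hconst.continuous.continuousAt.preimage_mem_nhds
      (Φ.open_target.mem_nhds htgt)] with x hx γ hγ0 hγ
    have h1 : picardDefect Xc (Φ.symm (BoundedContinuousFunction.const I x)) =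
        BoundedContinuousFunction.const I x := by
      rw [← hΦc, Φ.right_inv hx]
    obtain ⟨δ, hδ, hδ0, hδd⟩ := exists_hasDerivAt_of_picardDefect_eq h1
    have := eqOn_of_hasDerivAt (hX.of_le (by simp)) hδd hγ (hδ0.trans hγ0.symm)
      (right_mem_Icc.2 zero_le_one)
    rw [← this]
    exact (hδ 1).symm

end SmoothODE

section ScalarODE

/-- A scalar function, as a vector field on the manifold `ℝ`. -/
def lineField (h : ℝ → ℝ) : (x : ℝ) → TangentSpace 𝓘(ℝ, ℝ) x := h

theorem isMIntegralCurveOn_lineField {h : ℝ → ℝ} {s : ℝ → ℝ} {u : Set ℝ} (hu : IsOpen u) :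
    IsMIntegralCurveOn s (lineField h) u ↔ ∀ t ∈ u, HasDerivAt s (h (s t)) t := by
  refine forall₂_congr fun t ht => hasMFDerivWithinAt_iff_hasFDerivWithinAt.trans ?_
  exact ⟨fun H => by
      have H' : HasFDerivWithinAt s ((1 : ℝ →L[ℝ] ℝ).smulRight (h (s t))) u t := H
      simpa using (H'.hasFDerivAt (hu.mem_nhds ht)).hasDerivAt,
    fun H => (hasDerivAt_iff_hasFDerivAt.1 H).hasFDerivWithinAt⟩

theorem isMIntegralCurve_lineField {h : ℝ → ℝ} {s : ℝ → ℝ} :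
    IsMIntegralCurve s (lineField h) ↔ ∀ t, HasDerivAt s (h (s t)) t := by
  rw [isMIntegralCurve_iff_isMIntegralCurveOn, isMIntegralCurveOn_lineField isOpen_univ]
  simp

theorem contMDiff_lineField {h : ℝ → ℝ} (hh : ContDiff ℝ 1 h) :
    ContMDiff 𝓘(ℝ, ℝ) 𝓘(ℝ, ℝ).tangent 1
      (fun x : ℝ => (⟨x, lineField h x⟩ : TangentBundle 𝓘(ℝ, ℝ) ℝ)) := fun _ =>
  contMDiffAt_vectorSpace_iff_contDiffAt.2 hh.contDiffAt

/-- A bounded `C¹` autonomous scalar equation has global solutions. -/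
theorem exists_global_hasDerivAt {h : ℝ → ℝ} (hh : ContDiff ℝ 1 h) {C : ℝ} (hC : ∀ s, |h s| ≤ C) :
    ∃ s : ℝ → ℝ, s 0 = 0 ∧ ∀ t, HasDerivAt s (h (s t)) t := by
  have key := (exists_isMIntegralCurve_iff_exists_isMIntegralCurveOn_Ioo
    (contMDiff_lineField hh) 0).2 ?_
  · obtain ⟨s, h0, hs⟩ := key
    exact ⟨s, h0, isMIntegralCurve_lineField.1 hs⟩
  intro a
  rcases le_or_gt a 0 with ha | ha
  · refine ⟨fun _ => 0, rfl, fun t ht => absurd (ht.1.trans ht.2) (by linarith)⟩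
  -- a solution cannot travel further than `C * a` in time `a`, so that radius suffices
  have hC0 : 0 ≤ C := (abs_nonneg _).trans (hC 0)
  obtain ⟨K, hK⟩ := hh.locallyLipschitz.locallyLipschitzOn.exists_lipschitzOnWith_of_compact
    (isCompact_closedBall (0 : ℝ) (C * a))
  have hpl : IsPicardLindelof (fun _ => h) (tmin := -a) (tmax := a) ⟨0, by constructor <;> linarith⟩
      (0 : ℝ) ⟨C * a, by positivity⟩ 0 ⟨C, hC0⟩ K := by
    refine IsPicardLindelof.of_time_independent (fun x _ => hC x) hK ?_
    have : max (a - 0) (0 - -a) = a := by simp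
    exact (congrArg (C * ·) this).le.trans_eq (sub_zero (C * a)).symm
  obtain ⟨s, hs0, hs⟩ := hpl.exists_eq_forall_mem_Icc_hasDerivWithinAt₀
  refine ⟨s, hs0, (isMIntegralCurveOn_lineField isOpen_Ioo).2 fun t ht => ?_⟩
  exact (hs t (Ioo_subset_Icc_self ht)).hasDerivAt (Icc_mem_nhds ht.1 ht.2)

theorem global_solution_unique {h : ℝ → ℝ} (hh : ContDiff ℝ 1 h) {s r : ℝ → ℝ} {t₀ : ℝ}
    (hs : ∀ t, HasDerivAt s (h (s t)) t) (hr : ∀ t, HasDerivAt r (h (r t)) t) (h0 : s t₀ = r t₀) :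
    s = r :=
  isMIntegralCurve_Ioo_eq_of_contMDiff_boundaryless (contMDiff_lineField hh)
    (isMIntegralCurve_lineField.2 hs) (isMIntegralCurve_lineField.2 hr) h0

end ScalarODE

/-! ### Equations with a fixed direction, and cotangent coordinates -/

section FiberODE

/-- Smooth dependence, on base point `y`, initial value `p` and direction `q`, of the time-one value
of the equation `p' = g(y, p) q`. -/
theorem exists_contDiffAt_fiberTimeOne {F P : Type*} [NormedAddCommGroup F] [NormedSpace ℝ F]
    [FiniteDimensional ℝ F] [NormedAddCommGroup P] [NormedSpace ℝ P] [FiniteDimensional ℝ P]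
    {O : Set F} (hO : IsOpen O) {g : F × P → ℝ} (hg : ContDiffOn ℝ ∞ g (O ×ˢ univ))
    {y₀ : F} (hy₀ : y₀ ∈ O) (p₀ q₀ : P) {s₀ : ℝ → ℝ} (h0 : s₀ 0 = 0)
    (hs₀ : ∀ t, HasDerivAt s₀ (g (y₀, p₀ + s₀ t • q₀)) t) :
    ∃ R : F × P × P → P, ContDiffAt ℝ ∞ R (y₀, p₀, q₀) ∧
      ∀ᶠ z in 𝓝 (y₀, p₀, q₀), ∀ s : ℝ → ℝ, s 0 = 0 →
        (∀ t, HasDerivAt s (g (z.1, z.2.1 + s t • z.2.2)) t) → R z = z.2.1 + s 1 • z.2.2 := by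
  -- cut off in the base direction, to have a globally defined smooth equation
  obtain ⟨ε, hε, hεO⟩ := Metric.isOpen_iff.1 hO y₀ hy₀
  let χ : ContDiffBump y₀ := ⟨ε / 3, ε / 2, by positivity, by linarith⟩
  have hχO : tsupport χ ⊆ O := by
    rw [χ.tsupport_eq]
    exact (Metric.closedBall_subset_ball (half_lt_self hε)).trans hεO
  have hG : ContDiff ℝ ∞ (fun z : F × P => χ z.1 * g z) := by
    rw [contDiff_iff_contDiffAt]
    intro z
    by_cases hz : z.1 ∈ tsupport χ
    · have h1 : O ×ˢ (univ : Set P) ∈ 𝓝 z :=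
        (hO.prod isOpen_univ).mem_nhds ⟨hχO hz, mem_univ _⟩
      exact (χ.contDiff.comp contDiff_fst).contDiffAt.mul (hg.contDiffAt h1)
    · have h1 : ∀ᶠ w : F × P in 𝓝 z, w.1 ∈ (tsupport χ)ᶜ :=
        continuousAt_fst.eventually ((isClosed_tsupport _).isOpen_compl.mem_nhds hz)
      refine (contDiffAt_const (c := (0 : ℝ))).congr_of_eventuallyEq ?_
      filter_upwards [h1] with w hw
      rw [image_eq_zero_of_notMem_tsupport hw, zero_mul]
  set X : F × P × P → F × P × P := fun z => (0, (χ z.1 * g (z.1, z.2.1)) • z.2.2, 0) with hX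
  have hXs : ContDiff ℝ ∞ X := by
    have h1 : ContDiff ℝ ∞ fun z : F × P × P => χ z.1 * g (z.1, z.2.1) :=
      hG.comp (contDiff_fst.prodMk (contDiff_fst.comp contDiff_snd))
    exact contDiff_const.prodMk ((h1.smul (contDiff_snd.comp contDiff_snd)).prodMk contDiff_const)
  have hcurve : ∀ z : F × P × P, χ z.1 = 1 → ∀ s : ℝ → ℝ,
      (∀ t, HasDerivAt s (g (z.1, z.2.1 + s t • z.2.2)) t) →
      ∀ t, HasDerivAt (fun t => (z.1, z.2.1 + s t • z.2.2, z.2.2))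
        (X (z.1, z.2.1 + s t • z.2.2, z.2.2)) t := by
    intro z hz s hs t
    simp only [hX, hz, one_mul]
    exact (hasDerivAt_const t _).prodMk
      ((((hs t).smul_const z.2.2).const_add _).prodMk (hasDerivAt_const t _))
  have hone : ∀ᶠ y in 𝓝 y₀, χ y = 1 := χ.eventuallyEq_one
  obtain ⟨Θ, hΘ, hΘe⟩ := exists_contDiffAt_timeOne hXs
    (fun t _ => hcurve (y₀, p₀, q₀) hone.self_of_nhds s₀ hs₀ t)
  have hz₀ : ((y₀, p₀ + s₀ 0 • q₀, q₀) : F × P × P) = (y₀, p₀, q₀) := by simp [h0]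
  simp only [hz₀] at hΘ hΘe
  refine ⟨fun z => (Θ z).2.1, (contDiff_fst.comp contDiff_snd).contDiffAt.comp _ hΘ, ?_⟩
  filter_upwards [hΘe, continuousAt_fst.eventually hone] with z hz hz1 s hs0 hs
  rw [hz (fun t => (z.1, z.2.1 + s t • z.2.2, z.2.2)) (by simp [hs0])
    fun t _ => hcurve z hz1 s hs t]

end FiberODE

section CotangentCoordinates

variable {F L : Type*} [NormedAddCommGroup F] [NormedSpace ℝ F]
  [TopologicalSpace L] [ChartedSpace F L] [IsManifold 𝓘(ℝ, F) ∞ L]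

theorem cotangent_baseSet (x₀ : L) :
    (trivializationAt (F →L[ℝ] ℝ) (fun x : L => CotangentSpace F x) x₀).baseSet =
      (extChartAt 𝓘(ℝ, F) x₀).source := by
  rw [hom_trivializationAt_baseSet, TangentBundle.trivializationAt_baseSet, extChartAt_source]
  exact inter_univ _

theorem mem_cotangentChart_source {v₀ v : CotangentBundle F L} :
    v ∈ (extChartAt (cotangentModel F) v₀).source ↔ v.1 ∈ (extChartAt 𝓘(ℝ, F) v₀.1).source := by
  rw [FiberBundle.extChartAt, PartialEquiv.trans_source, ← cotangent_baseSet]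
  constructor
  · rintro ⟨h, -⟩
    exact (Bundle.Trivialization.mem_source _).1 h
  · intro h
    refine ⟨(Bundle.Trivialization.mem_source _).2 h, ?_, mem_univ _⟩
    rw [cotangent_baseSet] at h
    exact h

theorem cotangentChart_target (v₀ : CotangentBundle F L) :
    (extChartAt (cotangentModel F) v₀).target = (extChartAt 𝓘(ℝ, F) v₀.1).target ×ˢ univ := by
  rw [FiberBundle.extChartAt_target, cotangent_baseSet]
  congr 1
  exact inter_eq_left.2 (extChartAt 𝓘(ℝ, F) v₀.1).symm.mapsTo

/-- In the chart of `T^* L` induced by a chart `φ` of `L`, the covector `p` at `x` has the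
coordinates of its pullback under `φ⁻¹`. -/
theorem cotangentChart_apply (v₀ : CotangentBundle F L) {x : L}
    (hx : x ∈ (extChartAt 𝓘(ℝ, F) v₀.1).source) (p : CotangentSpace F x) :
    extChartAt (cotangentModel F) v₀ ⟨x, p⟩ = (extChartAt 𝓘(ℝ, F) v₀.1 x,
      (p.comp (mfderiv 𝓘(ℝ, F) 𝓘(ℝ, F) (extChartAt 𝓘(ℝ, F) v₀.1).symm (extChartAt 𝓘(ℝ, F) v₀.1 x)) :
        F →L[ℝ] ℝ)) := by
  have hx' : x ∈ (chartAt F v₀.1).source := by rwa [extChartAt_source] at hx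
  rw [FiberBundle.extChartAt]
  refine Prod.ext rfl ?_
  change (trivializationAt (F →L[ℝ] ℝ) (fun x : L => CotangentSpace F x) v₀.1 ⟨x, p⟩).2 = _
  rw [hom_trivializationAt_apply]
  change ((trivializationAt ℝ (Bundle.Trivial L ℝ) v₀.1).continuousLinearMapAt ℝ x).comp
    (p.comp ((trivializationAt F (TangentSpace 𝓘(ℝ, F)) v₀.1).symmL ℝ x)) = _
  rw [TangentBundle.symmL_trivializationAt hx']
  rw [ModelWithCorners.range_eq_univ, mfderivWithin_univ]
  have h1 : (trivializationAt ℝ (Bundle.Trivial L ℝ) v₀.1).continuousLinearMapAt ℝ x =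
      ContinuousLinearMap.id ℝ ℝ :=
    Bundle.Trivial.continuousLinearMapAt_trivialization ℝ L ℝ x
  rw [h1]
  rfl

theorem cotangentChart_add_smul (v₀ : CotangentBundle F L) {x : L}
    (hx : x ∈ (extChartAt 𝓘(ℝ, F) v₀.1).source) (p q : CotangentSpace F x) (s : ℝ) :
    extChartAt (cotangentModel F) v₀ ⟨x, p + s • q⟩ =
      (extChartAt 𝓘(ℝ, F) v₀.1 x, (extChartAt (cotangentModel F) v₀ ⟨x, p⟩).2 +
        s • (extChartAt (cotangentModel F) v₀ ⟨x, q⟩).2) := by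
  rw [cotangentChart_apply v₀ hx, cotangentChart_apply v₀ hx, cotangentChart_apply v₀ hx]
  rfl

theorem cotangentChart_fst (v₀ : CotangentBundle F L) {v : CotangentBundle F L}
    (hv : v.1 ∈ (extChartAt 𝓘(ℝ, F) v₀.1).source) :
    (extChartAt (cotangentModel F) v₀ v).1 = extChartAt 𝓘(ℝ, F) v₀.1 v.1 := by
  obtain ⟨x, p⟩ := v
  rw [cotangentChart_apply v₀ hv]

theorem cotangentChart_section (v₀ : CotangentBundle F L) (σ : CotangentSection F L) {x : L}
    (hx : x ∈ (extChartAt 𝓘(ℝ, F) v₀.1).source) :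
    extChartAt (cotangentModel F) v₀ ⟨x, σ x⟩ = (extChartAt 𝓘(ℝ, F) v₀.1 x,
      σ.inChart v₀.1 (extChartAt 𝓘(ℝ, F) v₀.1 x)) := by
  rw [cotangentChart_apply v₀ hx]
  simp only [CotangentSection.inChart]
  rw [(extChartAt 𝓘(ℝ, F) v₀.1).left_inv hx]

/-- The topology on sections refers to `inChart`, smoothness of sections to the bundle charts; both
give the same coordinates. -/
theorem contDiffOn_inChart (σ : CotangentSection F L) (x₀ : L) :
    ContDiffOn ℝ ∞ (σ.inChart x₀) (extChartAt 𝓘(ℝ, F) x₀).target := by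
  have h1 : ContMDiffOn 𝓘(ℝ, F) (cotangentModel F) ∞
      (fun y => (⟨(extChartAt 𝓘(ℝ, F) x₀).symm y, σ ((extChartAt 𝓘(ℝ, F) x₀).symm y)⟩ :
        CotangentBundle F L)) (extChartAt 𝓘(ℝ, F) x₀).target :=
    σ.contMDiff.comp_contMDiffOn (contMDiffOn_extChartAt_symm x₀)
  have h2 : ContMDiffOn (cotangentModel F) 𝓘(ℝ, F × (F →L[ℝ] ℝ)) ∞
      (extChartAt (cotangentModel F) (⟨x₀, 0⟩ : CotangentBundle F L))
      (extChartAt (cotangentModel F) (⟨x₀, 0⟩ : CotangentBundle F L)).source := by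
    rw [extChartAt_source]
    exact contMDiffOn_extChartAt
  have h3 := h2.comp h1 (fun y hy => by
    rw [mem_preimage, mem_cotangentChart_source]
    exact (extChartAt 𝓘(ℝ, F) x₀).map_target hy)
  refine (contDiff_snd.comp_contDiffOn h3.contDiffOn).congr fun y hy => ?_
  have := cotangentChart_section (⟨x₀, 0⟩ : CotangentBundle F L) σ
    ((extChartAt 𝓘(ℝ, F) x₀).map_target hy)
  simp only [Function.comp]
  rw [this, (extChartAt 𝓘(ℝ, F) x₀).right_inv hy]

theorem t2Space_cotangentBundle [T2Space L] : T2Space (CotangentBundle F L) := by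
  refine ⟨fun v w hvw => ?_⟩
  by_cases h : v.1 = w.1
  · set e := trivializationAt (F →L[ℝ] ℝ) (fun x : L => CotangentSpace F x) v.1
    have hv : v ∈ e.source := (Bundle.Trivialization.mem_source _).2
      (mem_baseSet_trivializationAt _ _ _)
    have hw : w ∈ e.source := (Bundle.Trivialization.mem_source _).2
      (h ▸ mem_baseSet_trivializationAt _ _ _)
    obtain ⟨U, U', hU, hU', hxU, hyU', hd⟩ := t2_separation fun h => hvw (e.injOn hv hw h)
    exact ⟨e.source ∩ e ⁻¹' U, e.source ∩ e ⁻¹' U',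
      e.continuousOn.isOpen_inter_preimage e.open_source hU,
      e.continuousOn.isOpen_inter_preimage e.open_source hU', ⟨hv, hxU⟩, ⟨hw, hyU'⟩,
      (hd.preimage e).mono inter_subset_right inter_subset_right⟩
  · exact separated_by_continuous (FiberBundle.continuous_proj _ _) h

end CotangentCoordinates

/-! ### The flow of a fiberwise constant vector field multiplied by a function -/

section ScalarFlow

/-- The solution of the autonomous scalar equation `s' = h(s)`, `s(0) = 0` (a junk value unless
there is a global solution). -/
def scalarFlow (h : ℝ → ℝ) : ℝ → ℝ :=
  Classical.epsilon fun s => s 0 = 0 ∧ ∀ t, HasDerivAt s (h (s t)) t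

theorem scalarFlow_spec {h : ℝ → ℝ} (hh : ContDiff ℝ 1 h) {C : ℝ} (hC : ∀ s, |h s| ≤ C) :
    scalarFlow h 0 = 0 ∧ ∀ t, HasDerivAt (scalarFlow h) (h (scalarFlow h t)) t :=
  Classical.epsilon_spec (exists_global_hasDerivAt hh hC)

theorem scalarFlow_unique {h : ℝ → ℝ} (hh : ContDiff ℝ 1 h) {s : ℝ → ℝ} (h0 : s 0 = 0)
    (hs : ∀ t, HasDerivAt s (h (s t)) t) : scalarFlow h = s := by
  have hsp : scalarFlow h 0 = 0 ∧ ∀ t, HasDerivAt (scalarFlow h) (h (scalarFlow h t)) t :=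
    Classical.epsilon_spec
      (p := fun s : ℝ → ℝ => s 0 = 0 ∧ ∀ t, HasDerivAt s (h (s t)) t) ⟨s, h0, hs⟩
  exact global_solution_unique hh hsp.2 hs (hsp.1.trans h0.symm)

/-- A solution that meets a zero of the right-hand side is constant. -/
theorem scalarFlow_eq_zero {h : ℝ → ℝ} (hh : ContDiff ℝ 1 h) {C : ℝ} (hC : ∀ s, |h s| ≤ C) {t : ℝ}
    (ht : h (scalarFlow h t) = 0) : scalarFlow h = 0 := by
  have h1 := scalarFlow_spec hh hC
  have h2 : scalarFlow h = fun _ => scalarFlow h t :=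
    global_solution_unique (t₀ := t) hh h1.2 (fun r => by
      rw [ht]; exact hasDerivAt_const r _) rfl
  have h3 := congrFun h2 0
  rw [h1.1] at h3
  rw [h2, ← h3]
  rfl

/-- Time reversal: from the point reached at time one, the reversed equation leads back. -/
theorem scalarFlow_reverse {h : ℝ → ℝ} (hh : ContDiff ℝ 1 h) {C : ℝ} (hC : ∀ s, |h s| ≤ C) :
    scalarFlow (fun r => h (scalarFlow h 1 - r)) 1 = scalarFlow h 1 := by
  obtain ⟨h0, hd⟩ := scalarFlow_spec hh hC
  have : scalarFlow (fun r => h (scalarFlow h 1 - r)) =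
      fun t => scalarFlow h 1 - scalarFlow h (1 - t) := by
    refine scalarFlow_unique (hh.comp (contDiff_const.sub contDiff_id)) (by simp) fun t => ?_
    have h2 := ((hd (1 - t)).comp_const_sub 1 t).const_sub (scalarFlow h 1)
    simpa using h2
  rw [this]
  simp [h0]

end ScalarFlow

section FiberFlow

variable {F L : Type*} [NormedAddCommGroup F] [NormedSpace ℝ F]
  [TopologicalSpace L] [ChartedSpace F L] [IsManifold 𝓘(ℝ, F) ∞ L]

theorem contMDiff_line (x : L) (p q : CotangentSpace F x) :
    ContMDiff 𝓘(ℝ, ℝ) (cotangentModel F) ∞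
      (fun t : ℝ => (⟨x, p + t • q⟩ : CotangentBundle F L)) := by
  set c := extChartAt (cotangentModel F) (⟨x, p⟩ : CotangentBundle F L) with hc
  have hx : x ∈ (extChartAt 𝓘(ℝ, F) x).source := mem_extChartAt_source x
  have h1 : (fun t : ℝ => (⟨x, p + t • q⟩ : CotangentBundle F L)) = fun t : ℝ =>
      c.symm (extChartAt 𝓘(ℝ, F) x x, (c ⟨x, p⟩).2 + t • (c ⟨x, q⟩).2) := by
    funext t
    have hs : (⟨x, p + t • q⟩ : CotangentBundle F L) ∈ c.source := mem_cotangentChart_source.2 hx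
    exact (c.left_inv hs).symm.trans
      (congrArg c.symm (cotangentChart_add_smul (⟨x, p⟩ : CotangentBundle F L) hx p q t))
  rw [h1]
  have h2 : ContMDiffOn 𝓘(ℝ, F × (F →L[ℝ] ℝ)) (cotangentModel F) ∞ c.symm c.target :=
    contMDiffOn_extChartAt_symm _
  have h3 : ContDiff ℝ ∞ fun t : ℝ =>
      (extChartAt 𝓘(ℝ, F) x x, (c ⟨x, p⟩).2 + t • (c ⟨x, q⟩).2) :=
    contDiff_const.prodMk (contDiff_const.add (contDiff_id.smul contDiff_const))
  refine h2.comp_contMDiff h3.contMDiff fun t => ?_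
  rw [hc, cotangentChart_target]
  exact ⟨mem_extChartAt_target x, mem_univ _⟩

/-- The time parameter along the fiber line `t ↦ p + t q`, under the field `G q`. -/
def fiberTime (G : CotangentBundle F L → ℝ) (x : L) (p q : CotangentSpace F x) : ℝ → ℝ :=
  scalarFlow fun s => G ⟨x, p + s • q⟩

/-- The time-one flow of the field `G · X_σ` on `T^* L`. -/
def fiberFlow (G : CotangentBundle F L → ℝ) (σ : CotangentSection F L) (v : CotangentBundle F L) :
    CotangentBundle F L :=
  ⟨v.1, v.2 + fiberTime G v.1 v.2 (σ v.1) 1 • σ v.1⟩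

/-- The coordinate expression of the fiber component of the flow, with the value of the section as
an independent variable: `(y, p, q) ↦ p + s(1) q`, where `s' = G(y, p + s q)`. -/
def fiberFlowCoord (G : CotangentBundle F L → ℝ) (v₀ : CotangentBundle F L)
    (z : F × (F →L[ℝ] ℝ) × (F →L[ℝ] ℝ)) : F →L[ℝ] ℝ :=
  z.2.1 + scalarFlow (fun s => G ((extChartAt (cotangentModel F) v₀).symm
    (z.1, z.2.1 + s • z.2.2))) 1 • z.2.2

variable {G : CotangentBundle F L → ℝ}

theorem contDiff_comp_line (hG : ContMDiff (cotangentModel F) 𝓘(ℝ, ℝ) ∞ G) (x : L)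
    (p q : CotangentSpace F x) : ContDiff ℝ ∞ fun s : ℝ => G ⟨x, p + s • q⟩ :=
  (hG.comp (contMDiff_line x p q)).contDiff

theorem fiberTime_spec (hG : ContMDiff (cotangentModel F) 𝓘(ℝ, ℝ) ∞ G) {C : ℝ}
    (hC : ∀ v, |G v| ≤ C) (x : L) (p q : CotangentSpace F x) :
    fiberTime G x p q 0 = 0 ∧
      ∀ t, HasDerivAt (fiberTime G x p q) (G ⟨x, p + fiberTime G x p q t • q⟩) t :=
  scalarFlow_spec ((contDiff_comp_line hG x p q).of_le (by simp)) fun _ => hC _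

theorem fiberTime_eq_zero (hG : ContMDiff (cotangentModel F) 𝓘(ℝ, ℝ) ∞ G) {C : ℝ}
    (hC : ∀ v, |G v| ≤ C) {x : L} {p q : CotangentSpace F x} {t : ℝ}
    (ht : G ⟨x, p + fiberTime G x p q t • q⟩ = 0) : fiberTime G x p q = 0 :=
  scalarFlow_eq_zero ((contDiff_comp_line hG x p q).of_le (by simp)) (fun _ => hC _) ht

theorem add_smul_add_smul_neg {V : Type*} [AddCommGroup V] [Module ℝ V] (p q : V) (a s : ℝ) :
    p + a • q + s • (-q) = p + (a - s) • q := by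
  rw [sub_smul, smul_neg]
  abel

/-- The field of `-σ` is the opposite of that of `σ`, so that its flow runs backwards. -/
theorem fiberFlow_neg (hG : ContMDiff (cotangentModel F) 𝓘(ℝ, ℝ) ∞ G) {C : ℝ}
    (hC : ∀ v, |G v| ≤ C) (σ : CotangentSection F L) (v : CotangentBundle F L) :
    fiberFlow G (-σ) (fiberFlow G σ v) = v := by
  obtain ⟨x, p⟩ := v
  have h1 := scalarFlow_reverse
    ((contDiff_comp_line hG x p (σ x)).of_le (by simp : (1 : WithTop ℕ∞) ≤ ∞)) (fun _ => hC _)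
  set a := scalarFlow (fun s => G ⟨x, p + s • σ x⟩) 1 with ha
  have h2 : (fun s : ℝ => G ⟨x, (p + a • σ x) + s • (-σ) x⟩) =
      fun r => G ⟨x, p + (a - r) • σ x⟩ := by
    funext s
    exact congrArg (fun w : F →L[ℝ] ℝ => G ⟨x, w⟩) (add_smul_add_smul_neg (p : F →L[ℝ] ℝ) (σ x) a s)
  have h3 : fiberTime G x (p + a • σ x) ((-σ) x) 1 = a := (congrArg (scalarFlow · 1) h2).trans h1
  have h4 : p + a • σ x + fiberTime G x (p + a • σ x) ((-σ) x) 1 • (-σ) x = p := by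
    rw [h3]
    refine (add_smul_add_smul_neg (p : F →L[ℝ] ℝ) (σ x) a a).trans ?_
    rw [sub_self, zero_smul, add_zero]
  exact congrArg (fun w : F →L[ℝ] ℝ => (⟨x, w⟩ : CotangentBundle F L)) h4

theorem contDiffOn_comp_cotangentChart_symm (hG : ContMDiff (cotangentModel F) 𝓘(ℝ, ℝ) ∞ G)
    (v₀ : CotangentBundle F L) :
    ContDiffOn ℝ ∞ (fun z => G ((extChartAt (cotangentModel F) v₀).symm z))
      ((extChartAt 𝓘(ℝ, F) v₀.1).target ×ˢ univ) := by
  rw [← cotangentChart_target]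
  exact (hG.comp_contMDiffOn (contMDiffOn_extChartAt_symm v₀)).contDiffOn

/-- The map `R` involves no section, so its smoothness controls the flows of all sections at
once. -/
theorem contDiffAt_fiberFlowCoord [FiniteDimensional ℝ F]
    (hG : ContMDiff (cotangentModel F) 𝓘(ℝ, ℝ) ∞ G) {C : ℝ} (hC : ∀ v, |G v| ≤ C)
    (v₀ : CotangentBundle F L) {z : F × (F →L[ℝ] ℝ) × (F →L[ℝ] ℝ)}
    (hz : z.1 ∈ (extChartAt 𝓘(ℝ, F) v₀.1).target) :
    ContDiffAt ℝ ∞ (fiberFlowCoord G v₀) z := by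
  obtain ⟨y₀, p₀, q₀⟩ := z
  have hO : IsOpen (extChartAt 𝓘(ℝ, F) v₀.1).target := isOpen_extChartAt_target v₀.1
  have hg := contDiffOn_comp_cotangentChart_symm hG v₀
  have hh : ∀ z : F × (F →L[ℝ] ℝ) × (F →L[ℝ] ℝ), z.1 ∈ (extChartAt 𝓘(ℝ, F) v₀.1).target →
      ContDiff ℝ 1 fun s : ℝ => G ((extChartAt (cotangentModel F) v₀).symm
        (z.1, z.2.1 + s • z.2.2)) := by
    intro z hz
    rw [← contDiffOn_univ]
    refine (hg.of_le (by simp)).comp (t := _ ×ˢ univ) (contDiffOn_univ.2 (contDiff_const.prodMk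
      (contDiff_const.add (contDiff_id.smul contDiff_const)))) fun s _ => ⟨hz, mem_univ _⟩
  obtain ⟨h0, hd⟩ := scalarFlow_spec (hh (y₀, p₀, q₀) hz) fun _ => hC _
  obtain ⟨R, hR, hRe⟩ := exists_contDiffAt_fiberTimeOne hO hg hz p₀ q₀ h0 hd
  refine hR.congr_of_eventuallyEq ?_
  filter_upwards [hRe, continuousAt_fst.eventually (hO.mem_nhds hz)] with z hz hzO
  obtain ⟨h0, hd⟩ := scalarFlow_spec (hh z hzO) fun _ => hC _
  exact (hz _ h0 hd).symm

/-- In cotangent coordinates, the flow of `G · X_σ` is `(y, p) ↦ (y, R(y, p, σ(y)))`. -/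
theorem cotangentChart_fiberFlow (σ : CotangentSection F L) (v₀ : CotangentBundle F L)
    {v : CotangentBundle F L} (hv : v.1 ∈ (extChartAt 𝓘(ℝ, F) v₀.1).source) :
    extChartAt (cotangentModel F) v₀ (fiberFlow G σ v) =
      ((extChartAt (cotangentModel F) v₀ v).1, fiberFlowCoord G v₀
        ((extChartAt (cotangentModel F) v₀ v).1, (extChartAt (cotangentModel F) v₀ v).2,
          σ.inChart v₀.1 (extChartAt (cotangentModel F) v₀ v).1)) := by
  obtain ⟨x, p⟩ := v
  have hσ : σ.inChart v₀.1 (extChartAt (cotangentModel F) v₀ ⟨x, p⟩).1 =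
      (extChartAt (cotangentModel F) v₀ ⟨x, σ x⟩).2 := by
    rw [cotangentChart_section v₀ σ hv, cotangentChart_fst v₀ hv]
  rw [fiberFlow, cotangentChart_add_smul v₀ hv, cotangentChart_fst v₀ hv]
  rw [cotangentChart_fst v₀ hv] at hσ
  refine Prod.ext rfl ?_
  simp only [fiberFlowCoord, fiberTime, hσ]
  congr 4
  funext s
  rw [← cotangentChart_add_smul v₀ hv, PartialEquiv.left_inv]
  exact mem_cotangentChart_source.2 hv

theorem fiberFlow_zero (v : CotangentBundle F L) :
    fiberFlow G 0 v = v := by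
  obtain ⟨x, p⟩ := v
  have h : ∀ (r : F →L[ℝ] ℝ) (t : ℝ), r + t • (0 : F →L[ℝ] ℝ) = r := by simp
  exact congrArg (fun w : F →L[ℝ] ℝ => (⟨x, w⟩ : CotangentBundle F L)) (h p _)

theorem fiberFlowCoord_zero (v₀ : CotangentBundle F L) :
    ((extChartAt (cotangentModel F) v₀ v₀).1,
      fiberFlowCoord G v₀ ((extChartAt (cotangentModel F) v₀ v₀).1,
        (extChartAt (cotangentModel F) v₀ v₀).2, 0)) = extChartAt (cotangentModel F) v₀ v₀ := by
  have h := cotangentChart_fiberFlow (G := G) 0 v₀ (v := v₀) (mem_extChartAt_source v₀.1)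
  rw [fiberFlow_zero] at h
  exact h.symm

theorem contMDiff_fiberFlow [FiniteDimensional ℝ F]
    (hG : ContMDiff (cotangentModel F) 𝓘(ℝ, ℝ) ∞ G) {C : ℝ} (hC : ∀ v, |G v| ≤ C)
    (σ : CotangentSection F L) :
    ContMDiff (cotangentModel F) (cotangentModel F) ∞ (fiberFlow G σ) := by
  intro v₀
  set c := extChartAt (cotangentModel F) v₀ with hc
  have hv₀ : v₀ ∈ c.source := mem_extChartAt_source v₀
  have hct : IsOpen c.target := isOpen_extChartAt_target v₀
  have htgt : ∀ z : F × (F →L[ℝ] ℝ), z ∈ c.target ↔ z.1 ∈ (extChartAt 𝓘(ℝ, F) v₀.1).target := by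
    intro z; rw [hc, cotangentChart_target]; simp
  have h1 : ContMDiffAt (cotangentModel F) 𝓘(ℝ, F × (F →L[ℝ] ℝ)) ∞ c v₀ := contMDiffAt_extChartAt
  have hz₀ : (c v₀).1 ∈ (extChartAt 𝓘(ℝ, F) v₀.1).target := (htgt _).1 (c.map_source hv₀)
  have h2 : ContDiffAt ℝ ∞ (fun z : F × (F →L[ℝ] ℝ) =>
      (z.1, fiberFlowCoord G v₀ (z.1, z.2, σ.inChart v₀.1 z.1))) (c v₀) := by
    have h3 : ContDiffAt ℝ ∞ (σ.inChart v₀.1) (c v₀).1 :=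
      (contDiffOn_inChart σ v₀.1).contDiffAt ((isOpen_extChartAt_target v₀.1).mem_nhds hz₀)
    refine contDiffAt_fst.prodMk (ContDiffAt.comp (c v₀)
      (contDiffAt_fiberFlowCoord hG hC v₀ hz₀) ?_)
    exact contDiffAt_fst.prodMk (contDiffAt_snd.prodMk (h3.comp (c v₀) contDiffAt_fst))
  have h4 : ContMDiffAt 𝓘(ℝ, F × (F →L[ℝ] ℝ)) (cotangentModel F) ∞ c.symm
      ((c v₀).1, fiberFlowCoord G v₀ ((c v₀).1, (c v₀).2, σ.inChart v₀.1 (c v₀).1)) :=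
    (contMDiffOn_extChartAt_symm v₀).contMDiffAt (hct.mem_nhds ((htgt _).2 hz₀))
  refine ((h4.comp v₀ (h2.contMDiffAt.comp v₀ h1))).congr_of_eventuallyEq ?_
  filter_upwards [extChartAt_source_mem_nhds (I := cotangentModel F) v₀] with v hv
  have hv1 := mem_cotangentChart_source.1 hv
  simp only [Function.comp]
  rw [← cotangentChart_fiberFlow σ v₀ hv1, c.left_inv]
  exact mem_cotangentChart_source.2 hv1

end FiberFlow

/-! ### The flow on the manifold -/

section VerticalField

variable {F L : Type*} [NormedAddCommGroup F] [NormedSpace ℝ F]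
  [TopologicalSpace L] [ChartedSpace F L] [IsManifold 𝓘(ℝ, F) ∞ L]

/-- In cotangent coordinates, the vertical field of `σ` is `(0, σ̂)`. -/
theorem verticalField_eq_mfderiv_symm (σ : CotangentSection F L) (v₀ : CotangentBundle F L)
    {v : CotangentBundle F L} (hv : v.1 ∈ (extChartAt 𝓘(ℝ, F) v₀.1).source) :
    @Eq (F × (F →L[ℝ] ℝ)) (verticalField σ v)
      (mfderiv 𝓘(ℝ, F × (F →L[ℝ] ℝ)) (cotangentModel F) (extChartAt (cotangentModel F) v₀).symm
        (extChartAt (cotangentModel F) v₀ v)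
        ((0, σ.inChart v₀.1 (extChartAt (cotangentModel F) v₀ v).1) : F × (F →L[ℝ] ℝ))) := by
  obtain ⟨x, p⟩ := v
  set c := extChartAt (cotangentModel F) v₀ with hc
  set w : F × (F →L[ℝ] ℝ) := (0, σ.inChart v₀.1 (c ⟨x, p⟩).1) with hw
  have hA : (fun t : ℝ => (⟨x, p + t • σ x⟩ : CotangentBundle F L)) =
      c.symm ∘ fun t : ℝ => c ⟨x, p⟩ + t • w := by
    funext t
    have hs : (⟨x, p + t • σ x⟩ : CotangentBundle F L) ∈ c.source := mem_cotangentChart_source.2 hv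
    refine (c.left_inv hs).symm.trans (congrArg c.symm ?_)
    refine (cotangentChart_add_smul v₀ hv p (σ x) t).trans ?_
    rw [hw, cotangentChart_section v₀ σ hv, hc, cotangentChart_apply v₀ hv p]
    simp
  have h0 : c ⟨x, p⟩ + (0 : ℝ) • w = c ⟨x, p⟩ := by rw [zero_smul, add_zero]
  have hAd : HasMFDerivAt 𝓘(ℝ, ℝ) 𝓘(ℝ, F × (F →L[ℝ] ℝ)) (fun t : ℝ => c ⟨x, p⟩ + t • w) 0
      ((1 : ℝ →L[ℝ] ℝ).smulRight w) := by
    refine HasFDerivAt.hasMFDerivAt ?_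
    have := ((hasDerivAt_id (0 : ℝ)).smul_const w).const_add (c ⟨x, p⟩)
    have h := this.hasFDerivAt
    rw [one_smul, ← ContinuousLinearMap.smulRight_one_eq_toSpanSingleton] at h
    exact h
  obtain ⟨D, hD⟩ : ∃ D : F × (F →L[ℝ] ℝ) →L[ℝ] F × (F →L[ℝ] ℝ),
      D = mfderiv 𝓘(ℝ, F × (F →L[ℝ] ℝ)) (cotangentModel F) c.symm (c ⟨x, p⟩) := ⟨_, rfl⟩
  have hcd : ∀ z, z = c ⟨x, p⟩ → HasMFDerivAt 𝓘(ℝ, F × (F →L[ℝ] ℝ)) (cotangentModel F) c.symm z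
      D := by
    rw [hD]
    rintro _ rfl
    have ht : c ⟨x, p⟩ ∈ c.target := c.map_source (mem_cotangentChart_source.2 hv)
    exact (((contMDiffOn_extChartAt_symm v₀).contMDiffAt
      ((isOpen_extChartAt_target v₀).mem_nhds ht)).mdifferentiableAt (n := ∞)
        (by simp)).hasMFDerivAt
  have h1 : @Eq (ℝ →L[ℝ] F × (F →L[ℝ] ℝ)) (mfderiv 𝓘(ℝ, ℝ) (cotangentModel F)
      (c.symm ∘ fun t : ℝ => c ⟨x, p⟩ + t • w) 0) (D.comp ((1 : ℝ →L[ℝ] ℝ).smulRight w)) :=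
    (HasMFDerivAt.comp 0 (hcd _ h0) hAd).mfderiv
  have h2 : @Eq (F × (F →L[ℝ] ℝ)) (verticalField σ ⟨x, p⟩)
      (mfderiv 𝓘(ℝ, ℝ) (cotangentModel F) (c.symm ∘ fun t : ℝ => c ⟨x, p⟩ + t • w) 0 (1 : ℝ)) :=
    congrArg (fun k : ℝ → CotangentBundle F L =>
      ((mfderiv 𝓘(ℝ, ℝ) (cotangentModel F) k 0 (1 : ℝ) : F × (F →L[ℝ] ℝ)))) hA
  have h3 : D.comp ((1 : ℝ →L[ℝ] ℝ).smulRight w) 1 = D w := by simp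
  have h4 : D w = mfderiv 𝓘(ℝ, F × (F →L[ℝ] ℝ)) (cotangentModel F) c.symm (c ⟨x, p⟩) w :=
    congrArg (fun D' : F × (F →L[ℝ] ℝ) →L[ℝ] F × (F →L[ℝ] ℝ) => D' w) hD
  exact h2.trans ((congrArg (fun D' : ℝ →L[ℝ] F × (F →L[ℝ] ℝ) => D' 1) h1).trans (h3.trans h4))

end VerticalField

namespace WeinsteinData

variable {E M : Type*} [NormedAddCommGroup E] [NormedSpace ℝ E]
  [TopologicalSpace M] [ChartedSpace E M]
  {F L : Type*} [NormedAddCommGroup F] [NormedSpace ℝ F]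
  [TopologicalSpace L] [ChartedSpace F L] [IsManifold 𝓘(ℝ, F) ∞ L]
  {om : Omega E M 2} {ι : L → M} (W : WeinsteinData F om ι)

/-- The function `f ∘ ψ` on `T^* L`, extended by zero outside `V`. -/
def cutoff : CotangentBundle F L → ℝ := indicator W.ψ.source fun v => W.f (W.ψ v)

theorem cutoff_of_mem {v : CotangentBundle F L} (hv : v ∈ W.ψ.source) :
    W.cutoff v = W.f (W.ψ v) := indicator_of_mem hv _

theorem cutoff_symm {m : M} (hm : m ∈ W.ψ.target) : W.cutoff (W.ψ.symm m) = W.f m := by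
  rw [W.cutoff_of_mem (W.ψ.map_target hm), W.ψ.right_inv hm]

theorem cutoff_of_notMem {v : CotangentBundle F L} (hv : v ∉ W.ψ.source) :
    W.cutoff v = 0 := indicator_of_notMem hv _

theorem exists_abs_cutoff_le [CompactSpace M] : ∃ C : ℝ, ∀ v, |W.cutoff v| ≤ C := by
  obtain ⟨C, hC⟩ := isCompact_univ.exists_bound_of_continuousOn (f := W.f)
    W.f.contMDiff.continuous.continuousOn
  refine ⟨max C 0, fun v => ?_⟩
  by_cases hv : v ∈ W.ψ.source
  · rw [W.cutoff_of_mem hv]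
    exact (hC _ (mem_univ _)).trans (le_max_left _ _)
  · rw [W.cutoff_of_notMem hv, abs_zero]
    exact le_max_right _ _

/-- The support of `f` is compact in `U`, so that of `f ∘ ψ` is closed in `T^* L`. -/
theorem contMDiff_cutoff [CompactSpace M] [T2Space L] :
    ContMDiff (cotangentModel F) 𝓘(ℝ, ℝ) ∞ W.cutoff := by
  have := t2Space_cotangentBundle (F := F) (L := L)
  intro v
  by_cases hv : v ∈ W.ψ.source
  · have h1 : ContMDiffAt (cotangentModel F) 𝓘(ℝ, ℝ) ∞ (fun v => W.f (W.ψ v)) v :=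
      W.f.contMDiff.contMDiffAt.comp v
        ((W.smooth_ψ v hv).contMDiffAt (W.ψ.open_source.mem_nhds hv))
    refine h1.congr_of_eventuallyEq ?_
    filter_upwards [W.ψ.open_source.mem_nhds hv] with w hw using W.cutoff_of_mem hw
  · have hK : IsCompact (W.ψ.symm '' tsupport W.f) :=
      (isClosed_tsupport _).isCompact.image_of_continuousOn
        (W.ψ.continuousOn_symm.mono W.tsupport_f)
    have hvK : v ∉ W.ψ.symm '' tsupport W.f := by
      rintro ⟨m, hm, rfl⟩
      exact hv (W.ψ.map_target (W.tsupport_f hm))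
    refine (contMDiffAt_const (c := (0 : ℝ))).congr_of_eventuallyEq ?_
    filter_upwards [hK.isClosed.isOpen_compl.mem_nhds hvK] with w hw
    by_cases hws : w ∈ W.ψ.source
    · rw [W.cutoff_of_mem hws]
      refine image_eq_zero_of_notMem_tsupport fun h => hw ⟨W.ψ w, h, W.ψ.left_inv hws⟩
    · exact W.cutoff_of_notMem hws

/-- Outside `V` the cut-off function vanishes, so that a solution that leaves `V` is constant. -/
theorem fiberLine_mem_source [CompactSpace M] [T2Space L] {x : L} {p : CotangentSpace F x}
    (hp : (⟨x, p⟩ : CotangentBundle F L) ∈ W.ψ.source) (q : CotangentSpace F x) (t : ℝ) :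
    (⟨x, p + fiberTime W.cutoff x p q t • q⟩ : CotangentBundle F L) ∈ W.ψ.source := by
  obtain ⟨C, hC⟩ := W.exists_abs_cutoff_le
  by_contra h
  have h0 := fiberTime_eq_zero W.contMDiff_cutoff hC (W.cutoff_of_notMem h)
  apply h
  rw [h0, Pi.zero_apply]
  have h1 : p + (0 : ℝ) • q = p := by rw [zero_smul]; exact add_zero p
  rwa [h1]

theorem fiberFlow_mem_source [CompactSpace M] [T2Space L] (σ : CotangentSection F L)
    {v : CotangentBundle F L} (hv : v ∈ W.ψ.source) : fiberFlow W.cutoff σ v ∈ W.ψ.source :=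
  W.fiberLine_mem_source hv (σ v.1) 1

open Classical in
/-- The time-one flow on `M` of the field `f ψ_* X_σ`: the flow on `T^* L` transported by `ψ`, and
the identity outside `U`. -/
def flow (σ : CotangentSection F L) (m : M) : M :=
  if m ∈ W.ψ.target then W.ψ (fiberFlow W.cutoff σ (W.ψ.symm m)) else m

theorem flow_of_mem (σ : CotangentSection F L) {m : M} (hm : m ∈ W.ψ.target) :
    W.flow σ m = W.ψ (fiberFlow W.cutoff σ (W.ψ.symm m)) := if_pos hm

theorem flow_of_notMem (σ : CotangentSection F L) {m : M} (hm : m ∉ W.ψ.target) :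
    W.flow σ m = m := if_neg hm

theorem flow_of_eq_zero [CompactSpace M] [T2Space L] (σ : CotangentSection F L) {m : M}
    (hm : W.f m = 0) : W.flow σ m = m := by
  by_cases h : m ∈ W.ψ.target
  · obtain ⟨C, hC⟩ := W.exists_abs_cutoff_le
    rw [W.flow_of_mem σ h]
    have h1 : W.cutoff (W.ψ.symm m) = 0 := (W.cutoff_symm h).trans hm
    have hsp := fiberTime_spec W.contMDiff_cutoff hC
    generalize hv : W.ψ.symm m = v at h1
    obtain ⟨x, p⟩ := v
    have h3 : p + (0 : ℝ) • σ x = p := by rw [zero_smul]; exact add_zero p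
    have h2 : fiberTime W.cutoff x p (σ x) = 0 := by
      refine fiberTime_eq_zero W.contMDiff_cutoff hC (t := 0) ?_
      rw [(hsp x p (σ x)).1, h3, h1]
    have h4 : fiberFlow W.cutoff σ (⟨x, p⟩ : CotangentBundle F L) = ⟨x, p⟩ := by
      unfold fiberFlow
      rw [h2]
      exact congrArg (fun w : F →L[ℝ] ℝ => (⟨x, w⟩ : CotangentBundle F L)) h3
    rw [h4, ← hv, W.ψ.right_inv h]
  · exact W.flow_of_notMem σ h

theorem flow_zero (m : M) : W.flow 0 m = m := by
  by_cases h : m ∈ W.ψ.target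
  · rw [W.flow_of_mem 0 h]
    rw [fiberFlow_zero, W.ψ.right_inv h]
  · exact W.flow_of_notMem 0 h

theorem flow_neg_flow [CompactSpace M] [T2Space L] (σ : CotangentSection F L) (m : M) :
    W.flow (-σ) (W.flow σ m) = m := by
  by_cases h : m ∈ W.ψ.target
  · obtain ⟨C, hC⟩ := W.exists_abs_cutoff_le
    have hs := W.fiberFlow_mem_source σ (W.ψ.map_target h)
    rw [W.flow_of_mem σ h, W.flow_of_mem (-σ) (W.ψ.map_source hs), W.ψ.left_inv hs,
      fiberFlow_neg W.contMDiff_cutoff hC, W.ψ.right_inv h]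
  · rw [W.flow_of_notMem σ h, W.flow_of_notMem (-σ) h]

theorem contMDiff_flow [CompactSpace M] [T2Space L] [FiniteDimensional ℝ F]
    (σ : CotangentSection F L) : ContMDiff 𝓘(ℝ, E) 𝓘(ℝ, E) ∞ (W.flow σ) := by
  obtain ⟨C, hC⟩ := W.exists_abs_cutoff_le
  intro m
  by_cases h : m ∈ tsupport W.f
  · have hm := W.tsupport_f h
    have hs := W.fiberFlow_mem_source σ (W.ψ.map_target hm)
    have h1 : ContMDiffAt 𝓘(ℝ, E) 𝓘(ℝ, E) ∞
        (fun m => W.ψ (fiberFlow W.cutoff σ (W.ψ.symm m))) m :=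
      ((W.smooth_ψ _ hs).contMDiffAt (W.ψ.open_source.mem_nhds hs)).comp m
        ((contMDiff_fiberFlow W.contMDiff_cutoff hC σ _).comp m
          ((W.smooth_symm m hm).contMDiffAt (W.ψ.open_target.mem_nhds hm)))
    refine h1.congr_of_eventuallyEq ?_
    filter_upwards [W.ψ.open_target.mem_nhds hm] with n hn using W.flow_of_mem σ hn
  · refine contMDiffAt_id.congr_of_eventuallyEq ?_
    filter_upwards [(isClosed_tsupport W.f).isOpen_compl.mem_nhds h] with n hn
    exact W.flow_of_eq_zero σ (image_eq_zero_of_notMem_tsupport hn)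

/-- The time-one flow as a diffeomorphism; the inverse is the flow of the opposite section. -/
def flowDiff [CompactSpace M] [T2Space L] [FiniteDimensional ℝ F] (σ : CotangentSection F L) :
    Diff E M where
  toFun := W.flow σ
  invFun := W.flow (-σ)
  left_inv := W.flow_neg_flow σ
  right_inv m := by simpa using W.flow_neg_flow (-σ) m
  contMDiff_toFun := W.contMDiff_flow σ
  contMDiff_invFun := W.contMDiff_flow (-σ)

/-- The field `f ψ_* X_σ` on `M`, for an arbitrary section `σ`. -/
def fieldOf (σ : CotangentSection F L) : (m : M) → TangentSpace 𝓘(ℝ, E) m :=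
  fun m => W.f m • VectorField.mpullback 𝓘(ℝ, E) (cotangentModel F) W.ψ.symm (verticalField σ) m

theorem mdifferentiableAt_ψ {v : CotangentBundle F L} (hv : v ∈ W.ψ.source) :
    MDifferentiableAt (cotangentModel F) 𝓘(ℝ, E) W.ψ v :=
  ((W.smooth_ψ v hv).contMDiffAt (W.ψ.open_source.mem_nhds hv)).mdifferentiableAt (by simp)

theorem mdifferentiableAt_ψ_symm {m : M} (hm : m ∈ W.ψ.target) :
    MDifferentiableAt 𝓘(ℝ, E) (cotangentModel F) W.ψ.symm m :=
  ((W.smooth_symm m hm).contMDiffAt (W.ψ.open_target.mem_nhds hm)).mdifferentiableAt (by simp)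

/-- On `U`, the pullback of a field by `ψ⁻¹` is its pushforward by `ψ`. -/
theorem mpullback_of_mem (X : (v : CotangentBundle F L) → TangentSpace (cotangentModel F) v)
    {v : CotangentBundle F L} (hv : v ∈ W.ψ.source) :
    @Eq E (VectorField.mpullback 𝓘(ℝ, E) (cotangentModel F) W.ψ.symm X (W.ψ v))
      (mfderiv (cotangentModel F) 𝓘(ℝ, E) W.ψ v (X v)) := by
  have hm := W.ψ.map_source hv
  have hl := W.ψ.left_inv hv
  set A : F × (F →L[ℝ] ℝ) →L[ℝ] E := mfderiv (cotangentModel F) 𝓘(ℝ, E) W.ψ v with hA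
  set B : E →L[ℝ] F × (F →L[ℝ] ℝ) := mfderiv 𝓘(ℝ, E) (cotangentModel F) W.ψ.symm (W.ψ v) with hB
  have hψ : ∀ w, w = v → HasMFDerivAt (cotangentModel F) 𝓘(ℝ, E) W.ψ w A := by
    rintro _ rfl; exact (W.mdifferentiableAt_ψ hv).hasMFDerivAt
  have hψs : HasMFDerivAt 𝓘(ℝ, E) (cotangentModel F) W.ψ.symm (W.ψ v) B :=
    (W.mdifferentiableAt_ψ_symm hm).hasMFDerivAt
  have h1 : B.comp A = ContinuousLinearMap.id ℝ _ := by
    have h := HasMFDerivAt.comp v hψs (hψ v rfl)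
    have h' : HasMFDerivAt (cotangentModel F) (cotangentModel F) (W.ψ.symm ∘ W.ψ) v
        (ContinuousLinearMap.id ℝ (F × (F →L[ℝ] ℝ))) := by
      refine (hasMFDerivAt_id v).congr_of_eventuallyEq ?_
      filter_upwards [W.ψ.open_source.mem_nhds hv] with w hw using W.ψ.left_inv hw
    exact hasMFDerivAt_unique h h'
  have h2 : A.comp B = ContinuousLinearMap.id ℝ _ := by
    have h := HasMFDerivAt.comp (W.ψ v) (hψ _ hl) hψs
    have h' : HasMFDerivAt 𝓘(ℝ, E) 𝓘(ℝ, E) (W.ψ ∘ W.ψ.symm) (W.ψ v)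
        (ContinuousLinearMap.id ℝ E) := by
      refine (hasMFDerivAt_id (W.ψ v)).congr_of_eventuallyEq ?_
      filter_upwards [W.ψ.open_target.mem_nhds hm] with w hw using W.ψ.right_inv hw
    exact hasMFDerivAt_unique h h'
  have h3 : B.inverse = A := ContinuousLinearMap.inverse_eq h1 h2
  have h4 : @Eq (F × (F →L[ℝ] ℝ)) (X (W.ψ.symm (W.ψ v))) (X v) :=
    congrArg (fun w => (X w : F × (F →L[ℝ] ℝ))) hl
  exact (congrArg B.inverse h4).trans
    (congrArg (fun D : F × (F →L[ℝ] ℝ) →L[ℝ] E => D (X v)) h3)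

theorem fieldOf_of_mem (σ : CotangentSection F L) {v : CotangentBundle F L}
    (hv : v ∈ W.ψ.source) :
    W.fieldOf σ (W.ψ v) = W.f (W.ψ v) •
      mfderiv (cotangentModel F) 𝓘(ℝ, E) W.ψ v (verticalField σ v) :=
  congrArg (fun w : E => W.f (W.ψ v) • w) (W.mpullback_of_mem (verticalField σ) hv)

theorem fieldOf_of_eq_zero (σ : CotangentSection F L) {m : M} (hm : W.f m = 0) :
    W.fieldOf σ m = 0 := by
  simp [fieldOf, hm]

theorem totalSpace_mk_eq {a b : M} {u w : E} (hab : a = b) (huw : u = w) :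
    (⟨a, u⟩ : TangentBundle 𝓘(ℝ, E) M) = ⟨b, w⟩ := by
  subst hab huw; rfl

/-- The regularity that makes integral curves of `f ψ_* X_σ` unique. -/
theorem contMDiff_fieldOf [IsManifold 𝓘(ℝ, E) ∞ M] (σ : CotangentSection F L) :
    ContMDiff 𝓘(ℝ, E) 𝓘(ℝ, E).tangent 1
      (fun m => (⟨m, W.fieldOf σ m⟩ : TangentBundle 𝓘(ℝ, E) M)) := by
  intro m₀
  by_cases h : m₀ ∈ tsupport W.f
  · have hm₀ := W.tsupport_f h
    refine ContMDiffAt.smul_section (W.f.contMDiff.contMDiffAt.of_le (by simp)) ?_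
    set v₀ := W.ψ.symm m₀ with hv₀
    set c := extChartAt (cotangentModel F) v₀ with hc
    have hct : IsOpen c.target := isOpen_extChartAt_target v₀
    have hcs : ContMDiffOn 𝓘(ℝ, F × (F →L[ℝ] ℝ)) (cotangentModel F) ∞ c.symm c.target :=
      contMDiffOn_extChartAt_symm v₀
    set N : Set (F × (F →L[ℝ] ℝ)) := c.target ∩ c.symm ⁻¹' W.ψ.source with hN
    have hNo : IsOpen N := hcs.continuousOn.isOpen_inter_preimage hct W.ψ.open_source
    have hk : ContMDiffOn 𝓘(ℝ, F × (F →L[ℝ] ℝ)) 𝓘(ℝ, E) ∞ (W.ψ ∘ c.symm) N :=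
      W.smooth_ψ.comp (hcs.mono inter_subset_left) inter_subset_right
    have hT := hk.contMDiffOn_tangentMapWithin (m := 1)
      (by norm_num; exact ENat.LEInfty.out)
      hNo.uniqueMDiffOn
    have hvs : v₀ ∈ W.ψ.source := W.ψ.map_target hm₀
    have hz₀ : c v₀ ∈ N := ⟨mem_extChartAt_target v₀, by
      rw [mem_preimage, c.left_inv (mem_extChartAt_source v₀)]; exact hvs⟩
    have hS : ContMDiffAt 𝓘(ℝ, F × (F →L[ℝ] ℝ)) 𝓘(ℝ, F × (F →L[ℝ] ℝ)).tangent 1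
        (fun z : F × (F →L[ℝ] ℝ) => (⟨z, ((0, σ.inChart v₀.1 z.1) : F × (F →L[ℝ] ℝ))⟩ :
          TangentBundle 𝓘(ℝ, F × (F →L[ℝ] ℝ)) (F × (F →L[ℝ] ℝ)))) (c v₀) := by
      refine contMDiffAt_vectorSpace_iff_contDiffAt.2 (contDiffAt_const.prodMk ?_)
      have hy : (c v₀).1 ∈ (extChartAt 𝓘(ℝ, F) v₀.1).target := by
        have := hz₀.1
        rw [hc, cotangentChart_target] at this
        exact this.1
      exact (((contDiffOn_inChart σ v₀.1).contDiffAt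
        ((isOpen_extChartAt_target v₀.1).mem_nhds hy)).of_le (by simp)).comp (c v₀) contDiffAt_fst
    have hz : ContMDiffAt 𝓘(ℝ, E) 𝓘(ℝ, F × (F →L[ℝ] ℝ)) 1 (fun m => c (W.ψ.symm m)) m₀ :=
      ((contMDiffAt_extChartAt (n := ∞)).comp m₀
        ((W.smooth_symm m₀ hm₀).contMDiffAt (W.ψ.open_target.mem_nhds hm₀))).of_le (by simp)
    have hcomp := ContMDiffAt.comp m₀ (ContMDiffAt.comp (c v₀)
      (hT.contMDiffAt ((hNo.preimage (FiberBundle.continuous_proj _ _)).mem_nhds hz₀)) hS) hz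
    refine hcomp.congr_of_eventuallyEq ?_
    have hcont : ContinuousAt W.ψ.symm m₀ := W.ψ.symm.continuousAt hm₀
    filter_upwards [W.ψ.open_target.mem_nhds hm₀, hcont.eventually
      (extChartAt_source_mem_nhds (I := cotangentModel F) v₀)] with m hm hmc
    have hv := W.ψ.map_target hm
    have hmv : m = W.ψ (W.ψ.symm m) := (W.ψ.right_inv hm).symm
    change _ = tangentMapWithin 𝓘(ℝ, F × (F →L[ℝ] ℝ)) 𝓘(ℝ, E) (W.ψ ∘ c.symm) N
      ⟨c (W.ψ.symm m), ((0, σ.inChart v₀.1 (c (W.ψ.symm m)).1) : F × (F →L[ℝ] ℝ))⟩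
    generalize W.ψ.symm m = v at hv hmc hmv ⊢
    subst hmv
    have hcl : c.symm (c v) = v := c.left_inv hmc
    refine totalSpace_mk_eq (congrArg W.ψ hcl).symm ?_
    refine (W.mpullback_of_mem (verticalField σ) hv).trans ?_
    have hzN : c v ∈ N := ⟨c.map_source hmc, by rwa [mem_preimage, hcl]⟩
    obtain ⟨A, hA⟩ : ∃ A : F × (F →L[ℝ] ℝ) →L[ℝ] E,
      A = mfderiv (cotangentModel F) 𝓘(ℝ, E) W.ψ v := ⟨_, rfl⟩
    obtain ⟨D, hD⟩ : ∃ D : F × (F →L[ℝ] ℝ) →L[ℝ] F × (F →L[ℝ] ℝ),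
      D = mfderiv 𝓘(ℝ, F × (F →L[ℝ] ℝ)) (cotangentModel F) c.symm (c v) := ⟨_, rfl⟩
    obtain ⟨w, hw⟩ : ∃ w : F × (F →L[ℝ] ℝ), w = (0, σ.inChart v₀.1 (c v).1) := ⟨_, rfl⟩
    have hAd : ∀ v', v' = v → HasMFDerivAt (cotangentModel F) 𝓘(ℝ, E) W.ψ v' A := by
      rw [hA]; rintro _ rfl; exact (W.mdifferentiableAt_ψ hv).hasMFDerivAt
    have hDd : HasMFDerivAt 𝓘(ℝ, F × (F →L[ℝ] ℝ)) (cotangentModel F) c.symm (c v) D := by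
      rw [hD]
      exact ((hcs.contMDiffAt (hct.mem_nhds hzN.1)).mdifferentiableAt (by simp)).hasMFDerivAt
    have h1 : @Eq (F × (F →L[ℝ] ℝ) →L[ℝ] E) (mfderivWithin 𝓘(ℝ, F × (F →L[ℝ] ℝ)) 𝓘(ℝ, E)
        (W.ψ ∘ c.symm) N (c v)) (A.comp D) :=
      (mfderivWithin_of_isOpen hNo hzN).trans (HasMFDerivAt.comp (c v) (hAd _ hcl) hDd).mfderiv
    have h2 : @Eq (F × (F →L[ℝ] ℝ)) (verticalField σ v) (D w) := by
      rw [hw, hD]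
      exact verticalField_eq_mfderiv_symm σ v₀ (mem_cotangentChart_source.1 hmc)
    have h3 : @Eq E (mfderiv (cotangentModel F) 𝓘(ℝ, E) W.ψ v (verticalField σ v)) (A (D w)) := by
      rw [← h2, hA]
      rfl
    refine h3.trans ?_
    rw [hw]
    exact (congrArg (fun B : F × (F →L[ℝ] ℝ) →L[ℝ] E =>
      B (0, σ.inChart v₀.1 (c v).1)) h1).symm
  · have h0 : ContMDiffAt 𝓘(ℝ, E) 𝓘(ℝ, E).tangent 1
        (fun m => (⟨m, 0⟩ : TangentBundle 𝓘(ℝ, E) M)) m₀ :=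
      Bundle.contMDiffAt_zeroSection ℝ (TangentSpace 𝓘(ℝ, E))
    refine h0.congr_of_eventuallyEq ?_
    filter_upwards [(isClosed_tsupport W.f).isOpen_compl.mem_nhds h] with n hn
    rw [W.fieldOf_of_eq_zero σ (image_eq_zero_of_notMem_tsupport hn)]

/-- The images under `ψ` of the solutions in the fibers are integral curves on `M`. -/
theorem isMIntegralCurve_fiberLine [CompactSpace M] [T2Space L] (σ : CotangentSection F L)
    {v : CotangentBundle F L} (hv : v ∈ W.ψ.source) :
    IsMIntegralCurve
      (fun t => W.ψ ⟨v.1, v.2 + fiberTime W.cutoff v.1 v.2 (σ v.1) t • σ v.1⟩)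
      (W.fieldOf σ) := by
  obtain ⟨x, p⟩ := v
  obtain ⟨C, hC⟩ := W.exists_abs_cutoff_le
  intro t
  have hd := (fiberTime_spec W.contMDiff_cutoff hC x p (σ x)).2 t
  have hw := W.fiberLine_mem_source hv (σ x) t
  set s := fiberTime W.cutoff x p (σ x) with hs
  set w : CotangentBundle F L := ⟨x, p + s t • σ x⟩ with hwdef
  set line : ℝ → CotangentBundle F L := fun r => ⟨x, (p + s t • σ x) + r • σ x⟩ with hline
  have hline0 : line 0 = w := by
    have h : ∀ r q : F →L[ℝ] ℝ, r + (0 : ℝ) • q = r := by simp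
    exact congrArg (fun w : F →L[ℝ] ℝ => (⟨x, w⟩ : CotangentBundle F L)) (h _ _)
  have hγ : (fun τ => W.ψ ⟨x, p + s τ • σ x⟩) = W.ψ ∘ line ∘ fun τ => s τ - s t := by
    funext τ
    have h : ∀ (r q : F →L[ℝ] ℝ) (a b : ℝ), r + b • q = r + a • q + (b - a) • q := by
      intro r q a b; module
    exact congrArg (fun w : F →L[ℝ] ℝ => W.ψ (⟨x, w⟩ : CotangentBundle F L)) (h _ _ _ _)
  have h1 : HasMFDerivAt 𝓘(ℝ, ℝ) 𝓘(ℝ, ℝ) (fun τ => s τ - s t) t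
      ((1 : ℝ →L[ℝ] ℝ).smulRight (W.cutoff w)) :=
    HasFDerivAt.hasMFDerivAt (by
      have h := (hd.sub_const (s t)).hasFDerivAt
      rwa [← ContinuousLinearMap.smulRight_one_eq_toSpanSingleton] at h)
  obtain ⟨A, hA⟩ : ∃ A : F × (F →L[ℝ] ℝ) →L[ℝ] E,
    A = mfderiv (cotangentModel F) 𝓘(ℝ, E) W.ψ w := ⟨_, rfl⟩
  obtain ⟨D, hD⟩ : ∃ D : ℝ →L[ℝ] F × (F →L[ℝ] ℝ),
    D = mfderiv 𝓘(ℝ, ℝ) (cotangentModel F) line 0 := ⟨_, rfl⟩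
  have h2 : ∀ r, r = 0 → HasMFDerivAt 𝓘(ℝ, ℝ) (cotangentModel F) line r D := by
    rw [hD]
    rintro _ rfl
    exact ((contMDiff_line x (p + s t • σ x) (σ x)).contMDiffAt.mdifferentiableAt
      (by simp)).hasMFDerivAt
  have h3 : ∀ w', w' = w → HasMFDerivAt (cotangentModel F) 𝓘(ℝ, E) W.ψ w' A := by
    rw [hA]
    rintro _ rfl
    exact (W.mdifferentiableAt_ψ hw).hasMFDerivAt
  have h4 := HasMFDerivAt.comp t (h3 _ ((congrArg line (sub_self (s t))).trans hline0))
    (HasMFDerivAt.comp t (h2 _ (sub_self (s t))) h1)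
  have h5 : @Eq E (W.fieldOf σ (W.ψ w)) (W.cutoff w • A (D 1)) := by
    rw [W.cutoff_of_mem hw, hA, hD]
    exact W.fieldOf_of_mem σ hw
  have h6 : A.comp (D.comp ((1 : ℝ →L[ℝ] ℝ).smulRight (W.cutoff w))) =
      (1 : ℝ →L[ℝ] ℝ).smulRight (W.fieldOf σ (W.ψ w) : E) := by
    rw [h5]
    ext
    have h : D (W.cutoff w) = W.cutoff w • D 1 := by
      rw [← map_smul, smul_eq_mul, mul_one]
    simp only [ContinuousLinearMap.comp_apply, ContinuousLinearMap.smulRight_apply,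
      one_apply_eq_self, one_smul, h, map_smul]
    exact (one_smul ℝ _).symm
  change HasMFDerivAt 𝓘(ℝ, ℝ) 𝓘(ℝ, E) (fun τ => W.ψ ⟨x, p + s τ • σ x⟩) t
    ((1 : ℝ →L[ℝ] ℝ).smulRight (W.fieldOf σ (W.ψ w) : E))
  rw [← h6, hγ]
  exact h4

theorem isTimeOneFlow_flowDiff [CompactSpace M] [T2Space L] [FiniteDimensional ℝ F]
    (σ : CotangentSection F L) :
    IsTimeOneFlow (W.fieldOf σ) (W.flowDiff σ) := by
  intro m
  by_cases hm : m ∈ W.ψ.target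
  · obtain ⟨C, hC⟩ := W.exists_abs_cutoff_le
    refine ⟨_, ?_, W.isMIntegralCurve_fiberLine σ (W.ψ.map_target hm), (W.flow_of_mem σ hm).symm⟩
    have h0 := (fiberTime_spec W.contMDiff_cutoff hC (W.ψ.symm m).1 (W.ψ.symm m).2
      (σ (W.ψ.symm m).1)).1
    have h1 : ∀ (v : CotangentBundle F L) (q : CotangentSpace F v.1),
        (⟨v.1, v.2 + (0 : ℝ) • q⟩ : CotangentBundle F L) = v := by
      rintro ⟨x, p⟩ q
      have h : ∀ r q : F →L[ℝ] ℝ, r + (0 : ℝ) • q = r := by simp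
      exact congrArg (fun w : F →L[ℝ] ℝ => (⟨x, w⟩ : CotangentBundle F L)) (h _ _)
    rw [h0]
    exact (congrArg W.ψ (h1 _ _)).trans (W.ψ.right_inv hm)
  · have hf : W.f m = 0 := image_eq_zero_of_notMem_tsupport fun h => hm (W.tsupport_f h)
    exact ⟨fun _ => m, rfl, isMIntegralCurve_const (W.fieldOf_of_eq_zero σ hf),
      (W.flow_of_notMem σ hm).symm⟩

theorem eq_flowDiff [CompactSpace M] [T2Space L] [T2Space M] [FiniteDimensional ℝ F]
    [CompleteSpace E] [IsManifold 𝓘(ℝ, E) ∞ M] (σ : CotangentSection F L) {Φ : Diff E M}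
    (hΦ : IsTimeOneFlow (W.fieldOf σ) Φ) : Φ = W.flowDiff σ := by
  ext m
  obtain ⟨γ, h0, hγ, h1⟩ := hΦ m
  obtain ⟨δ, h0', hδ, h1'⟩ := W.isTimeOneFlow_flowDiff σ m
  rw [← h1, ← h1', isMIntegralCurve_Ioo_eq_of_contMDiff_boundaryless (t₀ := 0)
    (W.contMDiff_fieldOf σ) hγ hδ (h0.trans h0'.symm)]

end WeinsteinData

/-! ### First jets of a composition, and of sections near the zero section -/

section Jets

open Filter

/-- The `C¹` continuity of `(σ, y) ↦ α(Θ_σ(β y))`, where `Θ_σ(a, p) = (a, R(a, p, σ(a)))`: the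
first jet at `y` depends on `σ` only through the first jet of `σ` at the base point of `β y`. -/
theorem tendsto_jet_comp {S E F P E' : Type*} [NormedAddCommGroup E] [NormedSpace ℝ E]
    [NormedAddCommGroup F] [NormedSpace ℝ F] [NormedAddCommGroup P] [NormedSpace ℝ P]
    [NormedAddCommGroup E'] [NormedSpace ℝ E']
    {l : Filter S} {β : E → F × P} {y₀ : E} {R : F × P × P → P} {α : F × P → E'}
    {σ : S → F → P} {O : Set F} {s₀ : S} (hO : IsOpen O) (hO₀ : (β y₀).1 ∈ O)
    (hσ : ∀ s, DifferentiableOn ℝ (σ s) O) (hs₀ : σ s₀ = 0)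
    (hlim : Tendsto (fun q : S × F => (σ q.1 q.2, fderiv ℝ (σ q.1) q.2)) (l ×ˢ 𝓝 (β y₀).1)
      (𝓝 (0, 0)))
    (hβ : ContDiffAt ℝ 1 β y₀) (hR : ContDiffAt ℝ 1 R ((β y₀).1, (β y₀).2, 0))
    (hα : ContDiffAt ℝ 1 α ((β y₀).1, R ((β y₀).1, (β y₀).2, 0))) :
    Tendsto (fun q : S × E => (α ((β q.2).1, R ((β q.2).1, (β q.2).2, σ q.1 (β q.2).1)),
        fderiv ℝ (fun y => α ((β y).1, R ((β y).1, (β y).2, σ q.1 (β y).1))) q.2)) (l ×ˢ 𝓝 y₀)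
      (𝓝 (α ((β y₀).1, R ((β y₀).1, (β y₀).2, σ s₀ (β y₀).1)),
        fderiv ℝ (fun y => α ((β y).1, R ((β y).1, (β y).2, σ s₀ (β y).1))) y₀)) := by
  -- the derivative of `Θ_σ ∘ β`, as a function of the derivatives `r`, `d`, `b` of `R`, `σ`, `β`
  let T : (F × P × P →L[ℝ] P) → (F →L[ℝ] P) → (E →L[ℝ] F × P) → (E →L[ℝ] F × P) := fun r d b =>
    ((ContinuousLinearMap.fst ℝ F P).comp b).prod
      (r.comp (((ContinuousLinearMap.fst ℝ F P).comp b).prod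
        (((ContinuousLinearMap.snd ℝ F P).comp b).prod
          (d.comp ((ContinuousLinearMap.fst ℝ F P).comp b)))))
  have hformula : ∀ s y, DifferentiableAt ℝ β y → (β y).1 ∈ O →
      DifferentiableAt ℝ R ((β y).1, (β y).2, σ s (β y).1) →
      DifferentiableAt ℝ α ((β y).1, R ((β y).1, (β y).2, σ s (β y).1)) →
      fderiv ℝ (fun y => α ((β y).1, R ((β y).1, (β y).2, σ s (β y).1))) y =
        (fderiv ℝ α ((β y).1, R ((β y).1, (β y).2, σ s (β y).1))).comp
          (T (fderiv ℝ R ((β y).1, (β y).2, σ s (β y).1)) (fderiv ℝ (σ s) (β y).1)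
            (fderiv ℝ β y)) := by
    intro s y h1 h2 h3 h4
    have hf := h1.hasFDerivAt.fst
    have hsd := ((hσ s).differentiableAt (hO.mem_nhds h2)).hasFDerivAt
    have hq := hsd.comp y hf
    have hr := h3.hasFDerivAt.comp y (hf.prodMk (h1.hasFDerivAt.snd.prodMk hq))
    exact (h4.hasFDerivAt.comp y (hf.prodMk hr)).fderiv
  have hb : Tendsto (fun q : S × E => β q.2) (l ×ˢ 𝓝 y₀) (𝓝 (β y₀)) :=
    hβ.continuousAt.tendsto.comp tendsto_snd
  have hb1 := (continuous_fst.tendsto _).comp hb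
  have hb2 := (continuous_snd.tendsto _).comp hb
  have hs := hlim.comp ((tendsto_fst (f := l) (g := 𝓝 y₀)).prodMk hb1)
  have hs1 : Tendsto (fun q : S × E => σ q.1 (β q.2).1) (l ×ˢ 𝓝 y₀) (𝓝 0) :=
    (continuous_fst.tendsto _).comp hs
  have hs2 : Tendsto (fun q : S × E => fderiv ℝ (σ q.1) (β q.2).1) (l ×ˢ 𝓝 y₀) (𝓝 0) :=
    (continuous_snd.tendsto _).comp hs
  have hz : Tendsto (fun q : S × E => ((β q.2).1, (β q.2).2, σ q.1 (β q.2).1)) (l ×ˢ 𝓝 y₀)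
      (𝓝 ((β y₀).1, (β y₀).2, 0)) := hb1.prodMk_nhds (hb2.prodMk_nhds hs1)
  have hw : Tendsto (fun q : S × E => ((β q.2).1, R ((β q.2).1, (β q.2).2, σ q.1 (β q.2).1)))
      (l ×ˢ 𝓝 y₀) (𝓝 ((β y₀).1, R ((β y₀).1, (β y₀).2, 0))) :=
    hb1.prodMk_nhds (hR.continuousAt.tendsto.comp hz)
  have hdβ : ContinuousAt (fderiv ℝ β) y₀ := (hβ.fderiv_right (m := 0) (by simp)).continuousAt
  have hdR : ContinuousAt (fderiv ℝ R) _ := (hR.fderiv_right (m := 0) (by simp)).continuousAt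
  have hdα : ContinuousAt (fderiv ℝ α) _ := (hα.fderiv_right (m := 0) (by simp)).continuousAt
  have hTc : Continuous fun q : (F × P × P →L[ℝ] P) × (F →L[ℝ] P) × (E →L[ℝ] F × P) =>
      T q.1 q.2.1 q.2.2 := by
    have hprod1 : Continuous fun q : (E →L[ℝ] F) × (E →L[ℝ] P) => q.1.prod q.2 :=
      (ContinuousLinearMap.prodₗᵢ (𝕜 := ℝ) (E := E) (F := F) (G := P) ℝ).continuous
    have hprod2 : Continuous fun q : (E →L[ℝ] P) × (E →L[ℝ] P) => q.1.prod q.2 :=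
      (ContinuousLinearMap.prodₗᵢ (𝕜 := ℝ) (E := E) (F := P) (G := P) ℝ).continuous
    have hprod3 : Continuous fun q : (E →L[ℝ] F) × (E →L[ℝ] P × P) => q.1.prod q.2 :=
      (ContinuousLinearMap.prodₗᵢ (𝕜 := ℝ) (E := E) (F := F) (G := P × P) ℝ).continuous
    have h1 : Continuous fun q : (F × P × P →L[ℝ] P) × (F →L[ℝ] P) × (E →L[ℝ] F × P) =>
      (ContinuousLinearMap.fst ℝ F P).comp q.2.2 := continuous_const.clm_comp (by fun_prop)
    have h2 : Continuous fun q : (F × P × P →L[ℝ] P) × (F →L[ℝ] P) × (E →L[ℝ] F × P) =>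
      (ContinuousLinearMap.snd ℝ F P).comp q.2.2 := continuous_const.clm_comp (by fun_prop)
    have h3 := (continuous_snd.fst : Continuous fun q : (F × P × P →L[ℝ] P) × (F →L[ℝ] P) ×
      (E →L[ℝ] F × P) => q.2.1).clm_comp h1
    exact hprod1.comp (h1.prodMk (continuous_fst.clm_comp
      (hprod3.comp (h1.prodMk (hprod2.comp (h2.prodMk h3))))))
  have hlimit : Tendsto (fun q : S × E =>
      (fderiv ℝ α ((β q.2).1, R ((β q.2).1, (β q.2).2, σ q.1 (β q.2).1))).comp
        (T (fderiv ℝ R ((β q.2).1, (β q.2).2, σ q.1 (β q.2).1)) (fderiv ℝ (σ q.1) (β q.2).1)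
          (fderiv ℝ β q.2))) (l ×ˢ 𝓝 y₀)
      (𝓝 ((fderiv ℝ α ((β y₀).1, R ((β y₀).1, (β y₀).2, 0))).comp
        (T (fderiv ℝ R ((β y₀).1, (β y₀).2, 0)) 0 (fderiv ℝ β y₀)))) :=
    ((isBoundedBilinearMap_comp.continuous).tendsto (_, _)).comp
      ((hdα.tendsto.comp hw).prodMk_nhds ((hTc.tendsto (_, _, _)).comp
        ((hdR.tendsto.comp hz).prodMk_nhds (hs2.prodMk_nhds (hdβ.tendsto.comp tendsto_snd)))))
  have hσ0 : ∀ x, σ s₀ x = 0 := fun x => congrFun hs₀ x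
  have hat := hformula s₀ y₀ (hβ.differentiableAt (by simp)) hO₀
    (by rw [hσ0]; exact hR.differentiableAt (by simp))
    (by rw [hσ0]; exact hα.differentiableAt (by simp))
  have hd0 : fderiv ℝ (σ s₀) (β y₀).1 = 0 := by rw [hs₀]; simp
  rw [hat, hσ0, hd0]
  refine (hα.continuousAt.tendsto.comp hw).prodMk_nhds (hlimit.congr' ?_)
  filter_upwards [tendsto_snd.eventually (hβ.eventually (by simp)),
    hb1.eventually (hO.mem_nhds hO₀),
    hz.eventually (hR.eventually (by simp)), hw.eventually (hα.eventually (by simp))]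
    with q h1 h2 h3 h4
  exact (hformula q.1 q.2 (h1.differentiableAt (by simp)) h2 (h3.differentiableAt (by simp))
    (h4.differentiableAt (by simp))).symm

/-- Convergence to the zero section in the `C¹` topology, read in a chart: the first jets converge
locally uniformly. -/
theorem tendsto_inChart_jet {F L : Type*} [NormedAddCommGroup F] [NormedSpace ℝ F]
    [FiniteDimensional ℝ F] [TopologicalSpace L] [ChartedSpace F L] [IsManifold 𝓘(ℝ, F) ∞ L]
    (x₀ : L) {y₀ : F} (hy₀ : y₀ ∈ (extChartAt 𝓘(ℝ, F) x₀).target) :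
    Tendsto (fun q : CotangentSection F L × F =>
      (q.1.inChart x₀ q.2, fderiv ℝ (q.1.inChart x₀) q.2)) (𝓝 0 ×ˢ 𝓝 y₀) (𝓝 (0, 0)) := by
  have := FiniteDimensional.proper_real F
  have h0 : (0 : CotangentSection F L).inChart x₀ = 0 := by
    funext y
    ext w
    rfl
  obtain ⟨K, hK, hKt, hKc⟩ := local_compact_nhds
    ((isOpen_extChartAt_target (I := 𝓘(ℝ, F)) x₀).mem_nhds hy₀)
  have hcont : Continuous fun σ : CotangentSection F L =>
      UniformOnFun.ofFun {K : Set F | K ⊆ (extChartAt 𝓘(ℝ, F) x₀).target ∧ IsCompact K}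
        (fun y => (σ.inChart x₀ y, fderiv ℝ (σ.inChart x₀) y)) :=
    continuous_iInf_dom (i := x₀) continuous_induced_dom
  have h1 := (UniformOnFun.tendsto_iff_tendstoUniformlyOn.1 (hcont.tendsto 0)) K ⟨hKt, hKc⟩
  have h2 : ∀ ε > 0, ∀ᶠ q : CotangentSection F L × F in 𝓝 0 ×ˢ 𝓝 y₀,
      dist (q.1.inChart x₀ q.2) 0 < ε ∧ dist (fderiv ℝ (q.1.inChart x₀) q.2) 0 < ε := by
    intro ε hε
    filter_upwards [(h1 _ (Metric.dist_mem_uniformity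
      (α := (F →L[ℝ] ℝ) × (F →L[ℝ] F →L[ℝ] ℝ)) hε)).prod_mk hK] with q hq
    have h2 : dist ((0 : CotangentSection F L).inChart x₀ q.2,
        fderiv ℝ ((0 : CotangentSection F L).inChart x₀) q.2)
        (q.1.inChart x₀ q.2, fderiv ℝ (q.1.inChart x₀) q.2) < ε := hq.1 q.2 hq.2
    have h3 := max_lt_iff.1 h2
    rw [h0, fderiv_zero] at h3
    exact ⟨(dist_comm _ _).trans_lt h3.1, (dist_comm _ _).trans_lt h3.2⟩
  refine Tendsto.prodMk_nhds ?_ ?_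
  · exact Metric.tendsto_nhds.2 fun ε hε => (h2 ε hε).mono fun q hq => hq.1
  · exact (Metric.tendsto_nhds (α := F →L[ℝ] F →L[ℝ] ℝ)).2 fun ε hε =>
      (h2 ε hε).mono fun q hq => hq.2

end Jets

/-! ### Continuity of the first jet of the flow -/

namespace WeinsteinData

open Filter

variable {E M : Type*} [NormedAddCommGroup E] [NormedSpace ℝ E]
  [TopologicalSpace M] [ChartedSpace E M]
  {F L : Type*} [NormedAddCommGroup F] [NormedSpace ℝ F] [FiniteDimensional ℝ F]
  [TopologicalSpace L] [ChartedSpace F L] [IsManifold 𝓘(ℝ, F) ∞ L]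
  {om : Omega E M 2} {ι : L → M} (W : WeinsteinData F om ι)

/-- The flow depends continuously on the section at the zero section, locally uniformly: convergence
along a product filter `𝓝 0 ×ˢ 𝓝 m₀` is uniform near `m₀`. -/
theorem tendsto_flow [CompactSpace M] [T2Space L] (m₀ : M) :
    Tendsto (fun q : CotangentSection F L × M => W.flow q.1 q.2) (𝓝 0 ×ˢ 𝓝 m₀) (𝓝 m₀) := by
  by_cases h : m₀ ∈ tsupport W.f
  · obtain ⟨C, hC⟩ := W.exists_abs_cutoff_le
    have hm₀ := W.tsupport_f h
    set v₀ := W.ψ.symm m₀ with hv₀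
    set c := extChartAt (cotangentModel F) v₀ with hc
    have hy : (c v₀).1 ∈ (extChartAt 𝓘(ℝ, F) v₀.1).target := by
      have := mem_extChartAt_target (I := cotangentModel F) v₀
      rw [cotangentChart_target] at this
      exact this.1
    have hψs : ContinuousAt W.ψ.symm m₀ := W.ψ.symm.continuousAt hm₀
    have hb : Tendsto (fun q : CotangentSection F L × M => c (W.ψ.symm q.2)) (𝓝 0 ×ˢ 𝓝 m₀)
        (𝓝 (c v₀)) :=
      ((continuousAt_extChartAt v₀).tendsto.comp hψs.tendsto).comp tendsto_snd
    have hb1 := (continuous_fst.tendsto _).comp hb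
    have hb2 := (continuous_snd.tendsto _).comp hb
    have hs : Tendsto (fun q : CotangentSection F L × M =>
        q.1.inChart v₀.1 (c (W.ψ.symm q.2)).1) (𝓝 0 ×ˢ 𝓝 m₀) (𝓝 0) :=
      (continuous_fst.tendsto _).comp
        ((tendsto_inChart_jet v₀.1 hy).comp (tendsto_fst.prodMk hb1))
    have hR := (contDiffAt_fiberFlowCoord W.contMDiff_cutoff hC v₀
      (z := ((c v₀).1, (c v₀).2, 0)) hy).continuousAt
    have hw := hb1.prodMk_nhds (hR.tendsto.comp (hb1.prodMk_nhds (hb2.prodMk_nhds hs)))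
    rw [fiberFlowCoord_zero v₀] at hw
    have hψ : Tendsto (fun z => W.ψ (c.symm z)) (𝓝 (c v₀)) (𝓝 m₀) := by
      have h1 : ContinuousAt W.ψ v₀ := W.ψ.continuousAt (W.ψ.map_target hm₀)
      have h2 := h1.tendsto.comp (c.left_inv (mem_extChartAt_source v₀) ▸
        (continuousAt_extChartAt_symm (I := cotangentModel F) v₀).tendsto)
      rwa [hv₀, W.ψ.right_inv hm₀] at h2
    refine (hψ.comp hw).congr' ?_
    filter_upwards [tendsto_snd.eventually (W.ψ.open_target.mem_nhds hm₀),
      tendsto_snd.eventually (hψs.eventually (extChartAt_source_mem_nhds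
        (I := cotangentModel F) v₀))] with q h1 h2
    have h3 := mem_cotangentChart_source.1 h2
    have h4 := cotangentChart_fiberFlow (G := W.cutoff) q.1 v₀ h3
    rw [W.flow_of_mem q.1 h1]
    refine congrArg W.ψ ((congrArg c.symm h4).symm.trans (c.left_inv ?_))
    exact mem_cotangentChart_source.2 h3
  · refine tendsto_snd.congr' ?_
    filter_upwards [tendsto_snd.eventually
      ((isClosed_tsupport W.f).isOpen_compl.mem_nhds h)] with q hq
    exact (W.flow_of_eq_zero q.1 (image_eq_zero_of_notMem_tsupport hq)).symm

/-- The first jet of the flow, read in a chart, depends continuously on the section at the zero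
section, locally uniformly. -/
theorem tendsto_flow_jet [CompactSpace M] [T2Space L] [IsManifold 𝓘(ℝ, E) ∞ M] (x₁ : M) {y₀ : E}
    (hy₀ : y₀ ∈ (extChartAt 𝓘(ℝ, E) x₁).target) :
    Tendsto (fun q : CotangentSection F L × E =>
      (extChartAt 𝓘(ℝ, E) x₁ (W.flow q.1 ((extChartAt 𝓘(ℝ, E) x₁).symm q.2)),
        fderiv ℝ (fun y => extChartAt 𝓘(ℝ, E) x₁ (W.flow q.1 ((extChartAt 𝓘(ℝ, E) x₁).symm y)))
          q.2)) (𝓝 0 ×ˢ 𝓝 y₀) (𝓝 (y₀, ContinuousLinearMap.id ℝ E)) := by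
  set e := extChartAt 𝓘(ℝ, E) x₁ with he
  have heo : IsOpen e.target := isOpen_extChartAt_target x₁
  have hec : ContinuousOn e.symm e.target := continuousOn_extChartAt_symm x₁
  -- near `y₀`, the identity in the chart `e`
  have hid : (fun y => e (e.symm y)) =ᶠ[𝓝 y₀] fun y => y := by
    filter_upwards [heo.mem_nhds hy₀] with y hy using e.right_inv hy
  have hd : fderiv ℝ (fun y => e (e.symm y)) y₀ = ContinuousLinearMap.id ℝ E :=
    hid.fderiv_eq.trans fderiv_fun_id
  by_cases h : e.symm y₀ ∈ tsupport W.f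
  · obtain ⟨C, hC⟩ := W.exists_abs_cutoff_le
    have hm₀ := W.tsupport_f h
    set v₀ := W.ψ.symm (e.symm y₀) with hv₀
    have hvs : v₀ ∈ W.ψ.source := W.ψ.map_target hm₀
    have hψv : W.ψ v₀ = e.symm y₀ := W.ψ.right_inv hm₀
    set c := extChartAt (cotangentModel F) v₀ with hc
    have hy : (c v₀).1 ∈ (extChartAt 𝓘(ℝ, F) v₀.1).target := by
      have := mem_extChartAt_target (I := cotangentModel F) v₀
      rw [cotangentChart_target] at this
      exact this.1
    have hes : ContMDiffAt 𝓘(ℝ, E) 𝓘(ℝ, E) ∞ e.symm y₀ :=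
      (contMDiffOn_extChartAt_symm x₁).contMDiffAt (heo.mem_nhds hy₀)
    have hψs : ContMDiffAt 𝓘(ℝ, E) (cotangentModel F) ∞ W.ψ.symm (e.symm y₀) :=
      (W.smooth_symm _ hm₀).contMDiffAt (W.ψ.open_target.mem_nhds hm₀)
    have hβ : ContDiffAt ℝ ∞ (fun y => c (W.ψ.symm (e.symm y))) y₀ :=
      ((contMDiffAt_extChartAt (n := ∞) (x := v₀)).comp y₀ (hψs.comp y₀ hes)).contDiffAt
    have hα : ContDiffAt ℝ ∞ (fun z => e (W.ψ (c.symm z))) (c v₀) := by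
      have h1 : c.symm (c v₀) = v₀ := c.left_inv (mem_extChartAt_source v₀)
      have h2 : ContMDiffAt 𝓘(ℝ, F × (F →L[ℝ] ℝ)) (cotangentModel F) ∞ c.symm (c v₀) :=
        (contMDiffOn_extChartAt_symm v₀).contMDiffAt
          ((isOpen_extChartAt_target v₀).mem_nhds (mem_extChartAt_target v₀))
      have h3 : ContMDiffAt (cotangentModel F) 𝓘(ℝ, E) ∞ W.ψ (c.symm (c v₀)) := by
        rw [h1]
        exact (W.smooth_ψ v₀ hvs).contMDiffAt (W.ψ.open_source.mem_nhds hvs)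
      have h4 : ContMDiffAt 𝓘(ℝ, E) 𝓘(ℝ, E) ∞ e (W.ψ (c.symm (c v₀))) := by
        rw [h1, hψv]
        exact contMDiffAt_extChartAt' (by simpa [he] using e.map_target hy₀)
      exact (h4.comp (c v₀) (h3.comp (c v₀) h2)).contDiffAt
    have hR : ContDiffAt ℝ ∞ (fiberFlowCoord W.cutoff v₀) ((c v₀).1, (c v₀).2, 0) :=
      contDiffAt_fiberFlowCoord W.contMDiff_cutoff hC v₀ hy
    have h0 : (0 : CotangentSection F L).inChart v₀.1 = 0 := by
      funext y
      ext w
      rfl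
    have hjet := tendsto_jet_comp (l := 𝓝 (0 : CotangentSection F L)) (s₀ := 0)
      (β := fun y => c (W.ψ.symm (e.symm y))) (y₀ := y₀) (R := fiberFlowCoord W.cutoff v₀)
      (α := fun z => e (W.ψ (c.symm z))) (σ := fun s : CotangentSection F L => s.inChart v₀.1)
      (isOpen_extChartAt_target v₀.1) hy
      (fun s => (contDiffOn_inChart s v₀.1).differentiableOn (by simp)) h0
      (tendsto_inChart_jet v₀.1 hy) (hβ.of_le (by simp)) (hR.of_le (by simp))
      (by
        refine ContDiffAt.of_le ?_ (show (1 : WithTop ℕ∞) ≤ ∞ by simp)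
        rw [fiberFlowCoord_zero v₀]
        exact hα)
    -- where the flow is given by its expression in cotangent coordinates
    set N : Set E := e.target ∩ e.symm ⁻¹' (W.ψ.target ∩ W.ψ.symm ⁻¹' c.source) with hN
    have hNo : IsOpen N := hec.isOpen_inter_preimage heo
      (W.ψ.symm.continuousOn.isOpen_inter_preimage W.ψ.open_target (isOpen_extChartAt_source v₀))
    have hN₀ : y₀ ∈ N := ⟨hy₀, hm₀, mem_extChartAt_source v₀⟩
    have hform : ∀ σ : CotangentSection F L, ∀ y ∈ N,
        e (W.ψ (c.symm ((c (W.ψ.symm (e.symm y))).1, fiberFlowCoord W.cutoff v₀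
          ((c (W.ψ.symm (e.symm y))).1, (c (W.ψ.symm (e.symm y))).2,
            σ.inChart v₀.1 (c (W.ψ.symm (e.symm y))).1)))) = e (W.flow σ (e.symm y)) := by
      rintro σ y ⟨-, h1, h2⟩
      have h3 := mem_cotangentChart_source.1 h2
      have h4 := cotangentChart_fiberFlow (G := W.cutoff) σ v₀ h3
      rw [W.flow_of_mem σ h1]
      refine congrArg (fun v => e (W.ψ v)) ((congrArg c.symm h4).symm.trans (c.left_inv ?_))
      exact mem_cotangentChart_source.2 h3
    have hformd : ∀ σ : CotangentSection F L, ∀ y ∈ N,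
        (fun y => e (W.ψ (c.symm ((c (W.ψ.symm (e.symm y))).1, fiberFlowCoord W.cutoff v₀
          ((c (W.ψ.symm (e.symm y))).1, (c (W.ψ.symm (e.symm y))).2,
            σ.inChart v₀.1 (c (W.ψ.symm (e.symm y))).1))))) =ᶠ[𝓝 y]
        fun y => e (W.flow σ (e.symm y)) := fun σ y hy =>
      (hNo.eventually_mem hy).mono fun z hz => hform σ z hz
    have hlim : ∀ y, e (W.flow 0 (e.symm y)) = e (e.symm y) := fun y => by rw [W.flow_zero]
    rw [hform 0 y₀ hN₀, (hformd 0 y₀ hN₀).fderiv_eq, funext hlim, hlim, hd, e.right_inv hy₀]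
      at hjet
    refine hjet.congr' ?_
    filter_upwards [tendsto_snd.eventually (hNo.mem_nhds hN₀)] with q hq
    exact Prod.ext (hform q.1 q.2 hq) (hformd q.1 q.2 hq).fderiv_eq
  · have hO : IsOpen (e.target ∩ e.symm ⁻¹' (tsupport W.f)ᶜ) :=
      hec.isOpen_inter_preimage heo (isClosed_tsupport W.f).isOpen_compl
    refine Tendsto.congr' ?_ (tendsto_snd.prodMk_nhds tendsto_const_nhds)
    filter_upwards [tendsto_snd.eventually (hO.mem_nhds ⟨hy₀, h⟩)] with q hq
    have h1 : ∀ y ∈ e.target ∩ e.symm ⁻¹' (tsupport W.f)ᶜ, e (W.flow q.1 (e.symm y)) = y := by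
      intro y hy
      rw [W.flow_of_eq_zero q.1 (image_eq_zero_of_notMem_tsupport hy.2), e.right_inv hy.1]
    have h2 : (fun y => e (W.flow q.1 (e.symm y))) =ᶠ[𝓝 q.2] fun y => y :=
      (hO.eventually_mem hq).mono h1
    exact Prod.ext (h1 _ hq).symm (h2.fderiv_eq.trans fderiv_fun_id).symm

end WeinsteinData

/-! ### Continuity in the topologies on diffeomorphisms and on forms -/

theorem WeinsteinData.toSection_base {E M : Type*} [NormedAddCommGroup E] [NormedSpace ℝ E]
    [TopologicalSpace M] [ChartedSpace E M] {F L : Type*} [NormedAddCommGroup F] [NormedSpace ℝ F]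
    [TopologicalSpace L] [ChartedSpace F L] [IsManifold 𝓘(ℝ, F) ∞ L] {om : Omega E M 2}
    {ι : L → M} (W : WeinsteinData F om ι) : W.toSection W.base = 0 :=
  (W.isImageOf_toSection W.base).unique
    ⟨W.zero_mem_V', congrArg range (funext fun x => (W.ψ_zero x).symm)⟩

section Topologies

open Filter

variable {E M : Type*} [NormedAddCommGroup E] [NormedSpace ℝ E]
  [TopologicalSpace M] [ChartedSpace E M]

/-- Evaluation of coordinate expressions is jointly continuous in the form and the point. -/
theorem Omega.tendsto_inChart [FiniteDimensional ℝ E] {k : ℕ} (α : Omega E M k) (x₀ : M) {y₀ : E}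
    (hy₀ : y₀ ∈ (extChartAt 𝓘(ℝ, E) x₀).target) :
    Tendsto (fun q : Omega E M k × E => Form.inChart 𝓘(ℝ, E) q.1.form x₀ q.2) (𝓝 α ×ˢ 𝓝 y₀)
      (𝓝 (Form.inChart 𝓘(ℝ, E) α.form x₀ y₀)) := by
  have := FiniteDimensional.proper_real E
  have ht := (isOpen_extChartAt_target (I := 𝓘(ℝ, E)) x₀).mem_nhds hy₀
  obtain ⟨K, hK, hKt, hKc⟩ := local_compact_nhds ht
  have hcont : Continuous fun β : Omega E M k =>
      UniformOnFun.ofFun {K : Set E | K ⊆ (extChartAt 𝓘(ℝ, E) x₀).target ∧ IsCompact K}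
        (Form.inChart 𝓘(ℝ, E) β.form x₀) :=
    continuous_iInf_dom (i := x₀) continuous_induced_dom
  have h1 := (UniformOnFun.tendsto_iff_tendstoUniformlyOn.1 (hcont.tendsto α)) K ⟨hKt, hKc⟩
  have h2 : ContinuousAt (Form.inChart 𝓘(ℝ, E) α.form x₀) y₀ :=
    (α.smooth x₀).continuousOn.continuousAt ht
  refine tendsto_comp_of_locally_uniform_limit (F := fun q : Omega E M k × E =>
    Form.inChart 𝓘(ℝ, E) q.1.form x₀) (g := Prod.snd) h2 tendsto_snd fun u hu => ⟨K, hK, ?_⟩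
  exact tendsto_fst.eventually (h1 u hu)

/-- Continuity of a family of forms in the `C⁰` topology follows from locally uniform convergence of
the coordinate expressions. -/
theorem Omega.continuousAt_of_tendsto {k : ℕ} {S : Type*} [TopologicalSpace S]
    {α : S → Omega E M k} {s₀ : S}
    (h : ∀ x₀ : M, ∀ y₀ ∈ (extChartAt 𝓘(ℝ, E) x₀).target, ∃ a : E [⋀^Fin k]→L[ℝ] ℝ,
      Tendsto (fun q : S × E => Form.inChart 𝓘(ℝ, E) (α q.1).form x₀ q.2) (𝓝 s₀ ×ˢ 𝓝 y₀)
        (𝓝 a)) : ContinuousAt α s₀ := by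
  refine (tendsto_iInf.2 fun x₀ => ?_).mono_right nhds_iInf.ge
  rw [nhds_induced, tendsto_comap_iff]
  refine UniformOnFun.tendsto_iff_tendstoUniformlyOn.2 ?_
  rintro K ⟨hKt, hKc⟩
  refine (tendstoLocallyUniformlyOn_iff_tendstoUniformlyOn_of_compact hKc).1 ?_
  refine tendstoLocallyUniformlyOn_iff_forall_tendsto.2 fun y₀ hy₀ => ?_
  obtain ⟨a, ha⟩ := h x₀ y₀ (hKt hy₀)
  have h1 := ha.mono_left (prod_mono_right (𝓝 s₀) (nhdsWithin_le_nhds (s := K)))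
  have h2 : Tendsto (fun q : S × E => (s₀, q.2)) (𝓝 s₀ ×ˢ 𝓝[K] y₀) (𝓝 s₀ ×ˢ 𝓝[K] y₀) :=
    tendsto_const_nhds.prodMk tendsto_snd
  exact ((h1.comp h2).prodMk_nhds h1).mono_right (nhds_le_uniformity a)

variable [IsManifold 𝓘(ℝ, E) ∞ M]

/-- The fiber coordinate on the tangent bundle is the derivative of the chart of the base. -/
theorem tangentBundle_trivializationAt_snd (x₀ : M) {v : TangentBundle 𝓘(ℝ, E) M}
    (hv : v.1 ∈ (extChartAt 𝓘(ℝ, E) x₀).source) :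
    (trivializationAt E (TangentSpace 𝓘(ℝ, E)) x₀ v).2 =
      mfderiv 𝓘(ℝ, E) 𝓘(ℝ, E) (extChartAt 𝓘(ℝ, E) x₀) v.1 v.2 := by
  have := IsManifold.of_le (I := 𝓘(ℝ, E)) (M := M) (m := 1) (n := ∞) (by simp)
  have hv' : v.1 ∈ (chartAt E x₀).source := by rwa [extChartAt_source] at hv
  have h := TangentBundle.continuousLinearMapAt_trivializationAt (I := 𝓘(ℝ, E)) hv'
  have h2 : (trivializationAt E (TangentSpace 𝓘(ℝ, E)) x₀ v).2 =
      (trivializationAt E (TangentSpace 𝓘(ℝ, E)) x₀).continuousLinearMapAt ℝ v.1 v.2 := by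
    rw [Bundle.Trivialization.continuousLinearMapAt_apply,
      Bundle.Trivialization.coe_linearMapAt_of_mem _ hv']
  exact h2.trans (congrArg (fun A : E →L[ℝ] E => A v.2) h)

/-- Continuity of a family of diffeomorphisms in the `C¹` topology follows from locally uniform
convergence of the tangent maps. -/
theorem Diff.continuousAt_of_tendsto {S : Type*} [TopologicalSpace S] {Φ : S → Diff E M} {s₀ : S}
    (h : ∀ v : TangentBundle 𝓘(ℝ, E) M, Tendsto (fun q : S × TangentBundle 𝓘(ℝ, E) M =>
      tangentMap 𝓘(ℝ, E) 𝓘(ℝ, E) (Φ q.1) q.2) (𝓝 s₀ ×ˢ 𝓝 v)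
      (𝓝 (tangentMap 𝓘(ℝ, E) 𝓘(ℝ, E) (Φ s₀) v))) : ContinuousAt Φ s₀ := by
  refine (Topology.IsInducing.induced Diff.tangent).continuousAt_iff.2 ?_
  refine ContinuousMap.tendsto_nhds_compactOpen.2 fun K hK U hU hKU => ?_
  refine hK.eventually_forall_of_forall_eventually fun v hv => ?_
  rw [nhds_prod_eq]
  exact h v (hU.mem_nhds (hKU hv))

/-- The coordinate expression of `Φ^* α` at a point depends on the first jet of `Φ` there and on the
value of `α` at the image point, if the image lies in the same chart. -/
theorem Form.inChart_pullback {k : ℕ} (α : Form 𝓘(ℝ, E) M k) {Φ : M → M}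
    (hΦ : ContMDiff 𝓘(ℝ, E) 𝓘(ℝ, E) ∞ Φ) (x₀ : M) {y : E}
    (hy : y ∈ (extChartAt 𝓘(ℝ, E) x₀).target)
    (hΦy : Φ ((extChartAt 𝓘(ℝ, E) x₀).symm y) ∈ (extChartAt 𝓘(ℝ, E) x₀).source) :
    Form.inChart 𝓘(ℝ, E) (Form.pullback 𝓘(ℝ, E) 𝓘(ℝ, E) Φ α) x₀ y =
      (Form.inChart 𝓘(ℝ, E) α x₀ (extChartAt 𝓘(ℝ, E) x₀
        (Φ ((extChartAt 𝓘(ℝ, E) x₀).symm y)))).compContinuousLinearMap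
        (fderiv ℝ (fun z => extChartAt 𝓘(ℝ, E) x₀ (Φ ((extChartAt 𝓘(ℝ, E) x₀).symm z))) y) := by
  set e := extChartAt 𝓘(ℝ, E) x₀ with he
  set g : E → E := fun z => e (Φ (e.symm z)) with hg
  have heo : IsOpen e.target := isOpen_extChartAt_target x₀
  have hsymm : ContMDiffOn 𝓘(ℝ, E) 𝓘(ℝ, E) ∞ e.symm e.target := contMDiffOn_extChartAt_symm x₀
  have hs : ∀ z ∈ e.target, HasMFDerivAt 𝓘(ℝ, E) 𝓘(ℝ, E) e.symm z
      (mfderiv 𝓘(ℝ, E) 𝓘(ℝ, E) e.symm z) := fun z hz =>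
    ((hsymm.contMDiffAt (heo.mem_nhds hz)).mdifferentiableAt (by simp)).hasMFDerivAt
  have hΦd : HasMFDerivAt 𝓘(ℝ, E) 𝓘(ℝ, E) Φ (e.symm y)
      (mfderiv 𝓘(ℝ, E) 𝓘(ℝ, E) Φ (e.symm y)) :=
    ((hΦ _).mdifferentiableAt (by simp)).hasMFDerivAt
  have hgd : HasMFDerivAt 𝓘(ℝ, E) 𝓘(ℝ, E) g y (fderiv ℝ g y) := by
    have h1 : ContMDiffAt 𝓘(ℝ, E) 𝓘(ℝ, E) ∞ e (Φ (e.symm y)) :=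
      contMDiffAt_extChartAt' (by simpa [he] using hΦy)
    have h2 : ContMDiffAt 𝓘(ℝ, E) 𝓘(ℝ, E) ∞ g y :=
      h1.comp y ((hΦ _).comp y (hsymm.contMDiffAt (heo.mem_nhds hy)))
    exact (h2.contDiffAt.differentiableAt (by simp)).hasFDerivAt.hasMFDerivAt
  have hev : e.symm ∘ g =ᶠ[𝓝 y] Φ ∘ e.symm := by
    have hc : ContinuousAt (fun z => Φ (e.symm z)) y :=
      hΦ.continuous.continuousAt.comp (hsymm.continuousOn.continuousAt (heo.mem_nhds hy))
    filter_upwards [hc.eventually ((isOpen_extChartAt_source (I := 𝓘(ℝ, E)) x₀).mem_nhds hΦy)]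
      with z hz using e.left_inv hz
  have hd := hasMFDerivAt_unique
    ((HasMFDerivAt.comp y (hs _ (e.map_source hΦy)) hgd).congr_of_eventuallyEq hev.symm)
    (HasMFDerivAt.comp y hΦd (hs y hy))
  have key : ∀ (p q : M) (A B : E →L[ℝ] E), p = q → A = B →
      (α p).compContinuousLinearMap A = (α q).compContinuousLinearMap B := by
    rintro p _ A _ rfl rfl; rfl
  exact (key _ _ _ _ (e.left_inv hΦy) hd).symm

end Topologies

namespace WeinsteinData

open Filter

variable {E M : Type*} [NormedAddCommGroup E] [NormedSpace ℝ E]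
  [TopologicalSpace M] [ChartedSpace E M] [IsManifold 𝓘(ℝ, E) ∞ M] [CompactSpace M]
  {F L : Type*} [NormedAddCommGroup F] [NormedSpace ℝ F] [FiniteDimensional ℝ F]
  [TopologicalSpace L] [ChartedSpace F L] [IsManifold 𝓘(ℝ, F) ∞ L] [T2Space L]
  {om : Omega E M 2} {ι : L → M} (W : WeinsteinData F om ι)

/-- In the trivialization of `TM` given by a chart, the tangent map is the derivative of the
coordinate expression, to which `tendsto_flow_jet` applies. -/
theorem tendsto_tangentMap_flow (v₀ : TangentBundle 𝓘(ℝ, E) M) :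
    Tendsto (fun q : CotangentSection F L × TangentBundle 𝓘(ℝ, E) M =>
      tangentMap 𝓘(ℝ, E) 𝓘(ℝ, E) (W.flow q.1) q.2) (𝓝 0 ×ˢ 𝓝 v₀) (𝓝 v₀) := by
  have hproj : Tendsto (fun v : TangentBundle 𝓘(ℝ, E) M => v.1) (𝓝 v₀) (𝓝 v₀.1) :=
    (FiberBundle.continuous_proj E (TangentSpace 𝓘(ℝ, E))).tendsto v₀
  set tr := trivializationAt E (TangentSpace 𝓘(ℝ, E)) v₀.1 with htr
  set e := extChartAt 𝓘(ℝ, E) v₀.1 with he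
  have heo : IsOpen e.source := isOpen_extChartAt_source v₀.1
  have hv₀ : v₀ ∈ tr.source := FiberBundle.mem_trivializationAt_proj_source
  have hflow : Tendsto (fun q : CotangentSection F L × TangentBundle 𝓘(ℝ, E) M =>
      W.flow q.1 q.2.1) (𝓝 0 ×ˢ 𝓝 v₀) (𝓝 v₀.1) :=
    (W.tendsto_flow v₀.1).comp (tendsto_fst.prodMk (hproj.comp tendsto_snd))
  refine (tr.tendsto_nhds_iff hv₀).2 ⟨hflow, ?_⟩
  have htrc : Tendsto (fun v => (tr v).2) (𝓝 v₀) (𝓝 (tr v₀).2) :=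
    (continuous_snd.tendsto _).comp (tr.continuousAt hv₀).tendsto
  have hjet := (W.tendsto_flow_jet v₀.1 (mem_extChartAt_target (I := 𝓘(ℝ, E)) v₀.1)).comp
    (tendsto_fst.prodMk (((continuousAt_extChartAt (I := 𝓘(ℝ, E)) v₀.1).tendsto.comp hproj).comp
      (tendsto_snd (f := 𝓝 (0 : CotangentSection F L)))))
  have hlim := (isBoundedBilinearMap_apply.continuous.tendsto (ContinuousLinearMap.id ℝ E,
    (tr v₀).2)).comp (((continuous_snd.tendsto _).comp hjet).prodMk_nhds
      (htrc.comp (tendsto_snd (f := 𝓝 (0 : CotangentSection F L)))))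
  refine hlim.congr' ?_
  filter_upwards [hflow.eventually (heo.mem_nhds (mem_extChartAt_source v₀.1)),
    (hproj.comp tendsto_snd).eventually (heo.mem_nhds (mem_extChartAt_source v₀.1))]
    with q hq1 hq2
  obtain ⟨σ, v⟩ := q
  obtain ⟨m, w⟩ := v
  have hm : m ∈ e.source := hq2
  have hΦm : W.flow σ m ∈ e.source := hq1
  have hed : ∀ n ∈ e.source, HasMFDerivAt 𝓘(ℝ, E) 𝓘(ℝ, E) e n
      (mfderiv 𝓘(ℝ, E) 𝓘(ℝ, E) e n) := fun n hn =>
    ((contMDiffAt_extChartAt' (n := ∞) (by simpa [he] using hn)).mdifferentiableAt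
      (by simp)).hasMFDerivAt
  have hΦ := W.contMDiff_flow σ
  have hΦd : HasMFDerivAt 𝓘(ℝ, E) 𝓘(ℝ, E) (W.flow σ) m
      (mfderiv 𝓘(ℝ, E) 𝓘(ℝ, E) (W.flow σ) m) :=
    ((hΦ _).mdifferentiableAt (by simp)).hasMFDerivAt
  set g : E → E := fun z => e (W.flow σ (e.symm z)) with hg
  have hgd : HasMFDerivAt 𝓘(ℝ, E) 𝓘(ℝ, E) g (e m) (fderiv ℝ g (e m)) := by
    have h1 : ContMDiffAt 𝓘(ℝ, E) 𝓘(ℝ, E) ∞ e (W.flow σ (e.symm (e m))) := by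
      rw [e.left_inv hm]
      exact contMDiffAt_extChartAt' (by simpa [he] using hΦm)
    have h2 : ContMDiffAt 𝓘(ℝ, E) 𝓘(ℝ, E) ∞ g (e m) :=
      h1.comp (e m) ((hΦ _).comp (e m) ((contMDiffOn_extChartAt_symm v₀.1).contMDiffAt
        ((isOpen_extChartAt_target v₀.1).mem_nhds (e.map_source hm))))
    exact (h2.contDiffAt.differentiableAt (by simp)).hasFDerivAt.hasMFDerivAt
  have hev : g ∘ e =ᶠ[𝓝 m] e ∘ W.flow σ := by
    filter_upwards [heo.mem_nhds hm] with n hn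
    simp only [hg, Function.comp_apply, e.left_inv hn]
  have hd := hasMFDerivAt_unique
    ((HasMFDerivAt.comp m hgd (hed m hm)).congr_of_eventuallyEq hev.symm)
    (HasMFDerivAt.comp m (hed _ hΦm) hΦd)
  have h1 := tangentBundle_trivializationAt_snd v₀.1 (v := ⟨m, w⟩) hm
  have h2 := tangentBundle_trivializationAt_snd v₀.1
    (v := tangentMap 𝓘(ℝ, E) 𝓘(ℝ, E) (W.flow σ) ⟨m, w⟩) hΦm
  refine Eq.trans ?_ h2.symm
  refine (congrArg (fderiv ℝ g (e m)) h1).trans ?_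
  exact congrArg (fun A : E →L[ℝ] E => A w) hd

theorem continuousAt_flowDiff :
    ContinuousAt (W.flowDiff : CotangentSection F L → Diff E M) 0 := by
  refine Diff.continuousAt_of_tendsto fun v => ?_
  have h : tangentMap 𝓘(ℝ, E) 𝓘(ℝ, E) (W.flowDiff (0 : CotangentSection F L)) v = v := by
    have h1 : ⇑(W.flowDiff (0 : CotangentSection F L)) = id := funext W.flow_zero
    rw [h1, tangentMap_id, id]
  rw [h]
  exact W.tendsto_tangentMap_flow v

theorem continuousAt_pullback_flowDiff [FiniteDimensional ℝ E] :
    ContinuousAt (fun p : Omega E M 2 × CotangentSection F L => (W.flowDiff p.2).pullback p.1)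
      (om, 0) := by
  refine Omega.continuousAt_of_tendsto fun x₀ y₀ hy₀ =>
    ⟨(Form.inChart 𝓘(ℝ, E) om.form x₀ y₀).compContinuousLinearMap (ContinuousLinearMap.id ℝ E), ?_⟩
  rw [nhds_prod_eq]
  set e := extChartAt 𝓘(ℝ, E) x₀ with he
  have ht := (isOpen_extChartAt_target (I := 𝓘(ℝ, E)) x₀).mem_nhds hy₀
  set l : Filter ((Omega E M 2 × CotangentSection F L) × E) := (𝓝 om ×ˢ 𝓝 0) ×ˢ 𝓝 y₀ with hl
  have hσ : Tendsto (fun q : (Omega E M 2 × CotangentSection F L) × E => q.1.2) l (𝓝 0) :=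
    tendsto_snd.comp tendsto_fst
  have hα : Tendsto (fun q : (Omega E M 2 × CotangentSection F L) × E => q.1.1) l (𝓝 om) :=
    tendsto_fst.comp tendsto_fst
  have hy : Tendsto (fun q : (Omega E M 2 × CotangentSection F L) × E => q.2) l (𝓝 y₀) :=
    tendsto_snd
  have hflow : Tendsto (fun q : (Omega E M 2 × CotangentSection F L) × E =>
      W.flow q.1.2 (e.symm q.2)) l (𝓝 (e.symm y₀)) :=
    (W.tendsto_flow _).comp (hσ.prodMk
      (((continuousOn_extChartAt_symm x₀).continuousAt ht).tendsto.comp hy))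
  have hjet := (W.tendsto_flow_jet x₀ hy₀).comp (hσ.prodMk hy)
  have hform := (om.tendsto_inChart x₀ hy₀).comp
    (hα.prodMk ((continuous_fst.tendsto _).comp hjet))
  have hlim := (contDiff_compContinuousLinearMap.continuous.tendsto _).comp
    (hform.prodMk_nhds ((continuous_snd.tendsto _).comp hjet))
  refine hlim.congr' ?_
  filter_upwards [hy.eventually ht, hflow.eventually
    ((isOpen_extChartAt_source (I := 𝓘(ℝ, E)) x₀).mem_nhds (e.map_target hy₀))] with q h1 h2
  exact (Form.inChart_pullback q.1.1.form (W.contMDiff_flow q.1.2) x₀ h1 h2).symm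

end WeinsteinData

end LagDef

end

theorem mainTheorem4
    {E M : Type*} [NormedAddCommGroup E] [NormedSpace ℝ E] [FiniteDimensional ℝ E]
    [TopologicalSpace M] [ChartedSpace E M] [IsManifold 𝓘(ℝ, E) ∞ M] [T2Space M] [CompactSpace M]
    {F L : Type*} [NormedAddCommGroup F] [NormedSpace ℝ F] [FiniteDimensional ℝ F]
    [TopologicalSpace L] [ChartedSpace F L] [IsManifold 𝓘(ℝ, F) ∞ L] [CompactSpace L]
    (om : LagDef.Omega E M 2) (hom : LagDef.IsSymplectic om)
    (ι : L → M) (hι : LagDef.IsLagrangian F om ι)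
    (W : LagDef.WeinsteinData F om ι) :
    (∀ L' : W.Nearby, ∃! Φ : LagDef.Diff E M, LagDef.IsTimeOneFlow (W.field L') Φ) ∧
    ∀ φ : W.Nearby → LagDef.Diff E M, (∀ L' : W.Nearby, LagDef.IsTimeOneFlow (W.field L') (φ L')) →
      ContinuousAt φ W.base ∧
      ContinuousAt (fun p : LagDef.Omega E M 2 × W.Nearby => (φ p.2).pullback p.1) (om, W.base) := by
  have hL : T2Space L := hι.isSmoothEmbedding.isEmbedding.t2Space
  have hE : CompleteSpace E := FiniteDimensional.complete ℝ E
  refine ⟨fun L' => ⟨W.flowDiff (W.toSection L'), W.isTimeOneFlow_flowDiff _,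
    fun Φ hΦ => W.eq_flowDiff _ hΦ⟩, fun φ hφ => ?_⟩
  obtain rfl : φ = fun L' => W.flowDiff (W.toSection L') :=
    funext fun L' => W.eq_flowDiff _ (hφ L')
  have hS : Continuous W.toSection := continuous_induced_dom
  have h1 := W.continuousAt_flowDiff
  have h2 := W.continuousAt_pullback_flowDiff
  rw [← W.toSection_base] at h1 h2
  refine ⟨h1.comp hS.continuousAt, ?_⟩
  exact ContinuousAt.comp (x := (om, W.base)) (f := fun p : LagDef.Omega E M 2 × W.Nearby =>
    (p.1, W.toSection p.2)) h2 (continuous_fst.prodMk (hS.comp continuous_snd)).continuousAt
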